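/- **Setting.** Consider a step-stress accelerated life test with $k\ge 2$ stress levels $x_1<\dots<x_k$, inspection times $0=t_0<t_1<\dots<t_L$ and times of stress change $\tau_i=t_{l_i}$, where $0=l_0<l_1<\dots<l_k=L$ (so $\tau_0=0$ and $\tau_k=t_L$ is the end of the test). Let $\Theta=(0,\infty)\times\mathbb R$. For $\theta=(\theta_0,\theta_1)\in\Theta$ let $\lambda_i=\theta_0e^{\theta_1x_i}$, $$a_{i-1}=\frac1{\lambda_i}\sum_{s=1}^{i-1}(\tau_s-\tau_{s-1})\lambda_s,\qquad a^*_{i-1}=\frac1{\lambda_i}\sum_{s=1}^{i-1}\lambda_s(\tau_s-\tau_{s-1})(x_s-x_i).$$ For $t\ge 0$ with $\tau_{i-1}\le t<\tau_i$ (for $i=k$: $t\ge\tau_{k-1}$) let $$G_T(t)=1-e^{-\lambda_i(t+a_{i-1}-\tau_{i-1})},\qquad g_T(t)=\lambda_ie^{-\lambda_i(t+a_{i-1}-\tau_{i-1})}.$$ The cell probabilities are $\pi_j(\theta)=G_T(t_j)-G_T(t_{j-1})$ for $1\le j\le L$ and $\pi_{L+1}(\theta)=1-G_T(t_L)$. Let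 $W=W(\theta)$ be the $(L+1)\times2$ matrix with rows $z_j-z_{j-1}$, $1\le j\le L+1$, where $z_0=z_{L+1}=0$ and, for $1\le j\le L$, $$z_j=g_T(t_j)\Big(\tfrac{t_j+a_{i-1}-\tau_{i-1}}{\theta_0},\ (t_j+a_{i-1}-\tau_{i-1})x_i+a_{i-1}^*\Big)^T,$$ $i$ being the stress level in force just after $t_j$ (and $i=k$ for $j=L$). For $\beta\ge0$ put $$J_\beta(\theta)=W^TD_\pi^{\beta-1}W,\qquad K_\beta(\theta)=W^T\big(D_\pi^{2\beta-1}-\pi^\beta(\pi^\beta)^T\big)W,$$ with $D_\pi=\operatorname{diag}(\pi_j(\theta))$ and $\pi^\beta=(\pi_j(\theta)^\beta)_j$, and, for $m\in\mathbb R^2$, $$\sigma^2_{\beta}(\theta)=m^TJ_\beta^{-1}(\theta)K_\beta(\theta)J_\beta^{-1}(\theta)m.$$ From failure counts $n=(n_1,\dots,n_{L+1})$ of $N$ devices let $\hat p=n/N$. A minimum density power divergence estimator $\hat\theta^\beta$ is a function of the counts that equals a minimizer over $\theta\in\Theta$ of $d_\beta(\hat p,\pi(\theta))$ whenever a minimizer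 exists (and is arbitrary otherwise), where $$d_\beta(p,q)=\sum_j\Big(q_j^{1+\beta}-(1+\tfrac1\beta)p_jq_j^\beta+\tfrac1\beta p_j^{1+\beta}\Big)\ (\beta>0),\qquad d_0(p,q)=\sum_jp_j\log\frac{p_j}{q_j}.$$ The Z-type statistic for $\mathrm H_0:m^T\theta=d$ is $Z_N(\hat\theta^\beta)=\sqrt N\,\sigma_\beta(\hat\theta^\beta)^{-1}\,(m^T\hat\theta^\beta-d)$. **Theorem.** Let $\beta\ge0$, $m\in\mathbb R^2\setminus\{0\}$, $d\in\mathbb R$, let $\boldsymbol\theta_0\in\Theta$ satisfy $m^T\boldsymbol\theta_0=d$, and let $\ell\in\mathbb R^2$ be fixed. For every $N\geq 1$ with $\boldsymbol\theta_N=\boldsymbol\theta_0+\ell/\sqrt N\in\Theta$ (hence for all large $N$) let the counts be multinomial with $N$ trials and probability vector $\pi(\boldsymbol\theta_N)$. Then, as $N\to\infty$, the Z-type statistic is asymptotically normal with unit variance and mean $(m^TJ_\beta^{-1}K_\beta J_\beta^{-1}m)^{-1/2}m^T\ell$, in both of the following senses (the mean being evaluated at $\boldsymbol\theta_0$, respectively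 at $\hat\theta^\beta$): $$Z_N(\hat\theta^\beta)\xrightarrow{\ d\ }\mathcal N\big(\sigma_\beta(\boldsymbol\theta_0)^{-1}m^T\ell,\,1\big)\qquad\text{and}\qquad Z_N(\hat\theta^\beta)-\sigma_\beta(\hat\theta^\beta)^{-1}m^T\ell\xrightarrow{\ d\ }\mathcal N(0,1).$$ -/

import Mathlib

open MeasureTheory ProbabilityTheory Filter
open scoped Topology Matrix

noncomputable section

/-- Design of a step-stress accelerated life test with `k ≥ 2` stress levels
`x₁ < ⋯ < x_k` and `L` inspection times `0 = t₀ < t₁ < ⋯ < t_L`. The times of stress change are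
inspection times: `τ_i = t_{l_i}` with `0 = l₀ < l₁ < ⋯ < l_k = L`; in particular `τ₀ = 0`, and
`τ_k = t_L` is the end of the experiment. The level with (zero-based) index `i : Fin k` is in
force from `τ i.castSucc` to `τ i.succ`. -/
structure StepStress (k L : ℕ) where
  two_le : 2 ≤ k
  x : Fin k → ℝ
  x_strictMono : StrictMono x
  t : Fin (L + 1) → ℝ
  t_zero : t 0 = 0
  t_strictMono : StrictMono t
  l : Fin (k + 1) → Fin (L + 1)
  l_zero : l 0 = 0
  l_last : l (Fin.last k) = Fin.last L
  l_strictMono : StrictMono l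

/-- The parameter space `Θ = (0, ∞) × ℝ`; a parameter is `θ = (θ 0, θ 1)`. -/
def paramSpace : Set (Fin 2 → ℝ) := {θ | 0 < θ 0}

namespace StepStress

variable {k L : ℕ} (D : StepStress k L)

/-- Times of stress change `τ₀ = 0, τ₁, …, τ_k`. -/
def τ (i : Fin (k + 1)) : ℝ := D.t (D.l i)

/-- Failure rate `λ_i(θ) = θ₀ exp (θ₁ x_i)` at the `i`-th stress level. -/
def rate (θ : Fin 2 → ℝ) (i : Fin k) : ℝ := θ 0 * Real.exp (θ 1 * D.x i)

/-- `a_{i-1}`: the age at stress level `i` equivalent to the exposure at the earlier levels. -/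
def a (θ : Fin 2 → ℝ) (i : Fin k) : ℝ :=
  (∑ s ∈ Finset.Iio i, (D.τ s.succ - D.τ s.castSucc) * D.rate θ s) / D.rate θ i

/-- `a*_{i-1}`. -/
def aStar (θ : Fin 2 → ℝ) (i : Fin k) : ℝ :=
  1 / D.rate θ i *
    ∑ s ∈ Finset.Iio i, D.rate θ s * (D.τ s.succ - D.τ s.castSucc) * (-D.x i + D.x s)

/-- The stress level at which the devices are tested just after time `u`: the last level whose
starting time is at most `u` (so the last level for every `u ≥ τ_{k-1}`). -/
def stage (u : ℝ) : Fin k :=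
  haveI : NeZero k := ⟨by have := D.two_le; omega⟩
  (Finset.univ.filter fun i : Fin k => D.τ i.castSucc ≤ u).sup id

/-- Lifetime distribution function `G_T` of the cumulative exposure model, for times `u ≥ 0`. -/
def G (θ : Fin 2 → ℝ) (u : ℝ) : ℝ :=
  1 - Real.exp (-D.rate θ (D.stage u) * (u + D.a θ (D.stage u) - D.τ (D.stage u).castSucc))

/-- Lifetime density `g_T`, for times `u ≥ 0`. -/
def g (θ : Fin 2 → ℝ) (u : ℝ) : ℝ :=
  D.rate θ (D.stage u) *
    Real.exp (-D.rate θ (D.stage u) * (u + D.a θ (D.stage u) - D.τ (D.stage u).castSucc))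

/-- Cell probabilities: `π_j = G_T(t_j) - G_T(t_{j-1})` for the `L` inspection intervals, and
`1 - G_T(t_L)` for survival, which is the last cell. -/
def cellProb (θ : Fin 2 → ℝ) : Fin (L + 1) → ℝ :=
  Fin.lastCases (1 - D.G θ (D.t (Fin.last L)))
    (fun j : Fin L => D.G θ (D.t j.succ) - D.G θ (D.t j.castSucc))

/-- The vectors `z_j`, `j = 0, …, L`, with `z₀ = 0`. -/
def z (θ : Fin 2 → ℝ) (j : Fin (L + 1)) : Fin 2 → ℝ :=
  if j = 0 then 0 else
    let i := D.stage (D.t j)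
    let s := D.t j + D.a θ i - D.τ i.castSucc
    D.g θ (D.t j) • ![s / θ 0, s * D.x i + D.aStar θ i]

/-- The `(L+1) × 2` matrix `W` with rows `z_j - z_{j-1}`, `j = 1, …, L + 1`, where
`z_{L+1} = 0`. -/
def W (θ : Fin 2 → ℝ) : Matrix (Fin (L + 1)) (Fin 2) ℝ :=
  Matrix.of (Fin.lastCases (motive := fun _ => Fin 2 → ℝ) (0 - D.z θ (Fin.last L))
    (fun j : Fin L => D.z θ j.succ - D.z θ j.castSucc))

/-- `J_β(θ) = Wᵀ D_π^{β-1} W`. -/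
def J (β : ℝ) (θ : Fin 2 → ℝ) : Matrix (Fin 2) (Fin 2) ℝ :=
  (D.W θ)ᵀ * Matrix.diagonal (fun j => D.cellProb θ j ^ (β - 1)) * D.W θ

/-- `K_β(θ) = Wᵀ (D_π^{2β-1} - π^β (π^β)ᵀ) W`. -/
def K (β : ℝ) (θ : Fin 2 → ℝ) : Matrix (Fin 2) (Fin 2) ℝ :=
  (D.W θ)ᵀ * (Matrix.diagonal (fun j => D.cellProb θ j ^ (2 * β - 1)) -
    Matrix.vecMulVec (fun j => D.cellProb θ j ^ β) (fun j => D.cellProb θ j ^ β)) * D.W θ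

/-- `mᵀ J_β⁻¹(θ) K_β(θ) J_β⁻¹(θ) m`. -/
def asympVar (β : ℝ) (m θ : Fin 2 → ℝ) : ℝ :=
  m ⬝ᵥ (((D.J β θ)⁻¹ * D.K β θ * (D.J β θ)⁻¹) *ᵥ m)

/-- The Z-type statistic
`√N (mᵀ J_β⁻¹(θ) K_β(θ) J_β⁻¹(θ) m)^{-1/2} (mᵀ θ - d)`, to be evaluated at an estimate `θ`. -/
def zStat (β : ℝ) (m : Fin 2 → ℝ) (d : ℝ) (N : ℕ) (θ : Fin 2 → ℝ) : ℝ :=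
  √(N : ℝ) * D.asympVar β m θ ^ (-(1 / 2) : ℝ) * (m ⬝ᵥ θ - d)

end StepStress

/-- Density power divergence between `p` and `q` with tuning parameter `β`; for `β = 0` it is
the Kullback-Leibler divergence (with `0 log 0 = 0`). -/
def dpd {ι : Type*} [Fintype ι] (β : ℝ) (p q : ι → ℝ) : ℝ :=
  if β = 0 then ∑ j, p j * Real.log (p j / q j)
  else ∑ j, (q j ^ (1 + β) - (1 + 1 / β) * (p j * q j ^ β) + 1 / β * p j ^ (β + 1))

/-- Empirical probability vector `(n_j / N)_j` of a vector of counts, `N` being their total. -/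
def empirical {ι : Type*} [Fintype ι] (n : ι → ℕ) (j : ι) : ℝ :=
  (n j : ℝ) / ((∑ i, n i : ℕ) : ℝ)

/-- `θhat` is a minimum density power divergence estimator: for every count vector it picks a
minimizer over `Θ` of the divergence between the empirical and the model probability vectors,
whenever there is one. Where no minimizer exists, its value is arbitrary. -/
def StepStress.IsMDPDE {k L : ℕ} (D : StepStress k L) (β : ℝ)
    (θhat : (Fin (L + 1) → ℕ) → Fin 2 → ℝ) : Prop :=
  ∀ n : Fin (L + 1) → ℕ, n ≠ 0 →
    (∃ θ ∈ paramSpace, IsMinOn (fun η => dpd β (empirical n) (D.cellProb η)) paramSpace θ) →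
    θhat n ∈ paramSpace ∧
      IsMinOn (fun η => dpd β (empirical n) (D.cellProb η)) paramSpace (θhat n)

/-- Multinomial law of the counts in `N` trials with probability vector `p`. -/
def multinomialLaw {ι : Type*} [Fintype ι] [DecidableEq ι] (N : ℕ) (p : ι → ℝ) :
    Measure (ι → ℕ) :=
  ∑ n ∈ Finset.piAntidiag Finset.univ N,
    ENNReal.ofReal ((Nat.multinomial Finset.univ n : ℝ) * ∏ j, p j ^ n j) • Measure.dirac n

end

/-! The argument is the delta method for a smooth, injectively parametrised multinomial family. In
terms of the cumulative hazard `H = ∑ λ_s · exposure_s`, survival at each inspection is `exp (-H)`,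
the cells are its successive differences, and `W` is the Jacobian of `cellProb`. At least two stress
levels make `W` injective (`W_mulVec_injective`) and let `θ` be recovered continuously from the cell
probabilities (`tendsto_of_tendsto_cellProb`).

The divergence is bounded below by a continuous function that vanishes only on the diagonal, so by
compactness small divergence forces closeness (`exists_dpd_lt_imp_dist_lt`). Hence minimizers exist
for frequencies near `cellProb θ₀`, and they converge to `θ₀`. The estimating equation `Wᵀ D_π^{β-1}
(π - p) = 0` then linearises to `θ̂ - θ₀ = J⁻¹ Wᵀ D_π^{β-1} (p - π) + o(p - π)`
(`isLittleO_estimator`). All of this is deterministic, stated along the filter `countsNear`.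

Probability enters through a triangular-array central limit theorem for multinomial frequencies,
proved by characteristic functions (`tendstoInDistribution_multinomial`). The local alternative
shifts the frequencies by `W ℓ / √N` to first order, which the linearised estimator maps back to `mᵀ
ℓ`; the variance of the linear form is exactly the sandwich `asympVar` (`asympVar_eq`), positive for
`m ≠ 0` (`asympVar_pos`). Slutsky's theorem absorbs the remainder and the estimated standard
deviation. -/

noncomputable section

/-! ### Telescoping sums over cells -/

section Telescoping

variable {E : Type*} [AddCommGroup E] {L : ℕ}

/-- Cell probabilities and rows of `W` are both successive differences whose last entry is
undifferenced; tail sums undo this, giving back survival probabilities and the vectors `-z`. -/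
lemma sum_Ici_lastCases_sub (f : Fin (L + 1) → E) (j : Fin (L + 1)) :
    ∑ i ∈ Finset.Ici j, (Fin.lastCases (motive := fun _ => E) (f (Fin.last L))
      (fun j : Fin L => f j.castSucc - f j.succ) i : E) = f j := by
  induction j using Fin.reverseInduction with
  | last =>
    have : Finset.Ici (Fin.last L) = {Fin.last L} := by
      ext i; simp [Fin.last_le_iff]
    rw [this]; simp
  | cast j ih =>
    have : Finset.Ici j.castSucc = insert j.castSucc (Finset.Ici j.succ) := by
      ext i
      simp only [Finset.mem_Ici, Finset.mem_insert, Fin.le_def, Fin.ext_iff, Fin.val_castSucc,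
        Fin.val_succ]
      omega
    rw [this, Finset.sum_insert (by simp [Fin.le_def]), ih]
    simp

end Telescoping

/-! ### The model in terms of the cumulative hazard -/

namespace StepStress

variable {k L : ℕ} (D : StepStress k L)

lemma τ_strictMono : StrictMono D.τ := D.t_strictMono.comp D.l_strictMono

lemma τ_zero : D.τ 0 = 0 := by simp [τ, D.l_zero, D.t_zero]

lemma τ_last : D.τ (Fin.last k) = D.t (Fin.last L) := by simp [τ, D.l_last]

lemma t_nonneg (j : Fin (L + 1)) : 0 ≤ D.t j := by
  rw [← D.t_zero]; exact D.t_strictMono.monotone (Fin.zero_le j)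

lemma t_le_last (j : Fin (L + 1)) : D.t j ≤ D.t (Fin.last L) :=
  D.t_strictMono.monotone (Fin.le_last j)

lemma rate_pos {θ : Fin 2 → ℝ} (hθ : θ ∈ paramSpace) (i : Fin k) : 0 < D.rate θ i :=
  mul_pos hθ (Real.exp_pos _)

/-- Time spent at the stress level `s` up to time `u`. -/
def exposure (s : Fin k) (u : ℝ) : ℝ := min u (D.τ s.succ) - min u (D.τ s.castSucc)

/-- Cumulative hazard at time `u`. -/
def cumHazard (θ : Fin 2 → ℝ) (u : ℝ) : ℝ := ∑ s, D.rate θ s * D.exposure s u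

lemma exposure_mono (s : Fin k) : Monotone (D.exposure s) := by
  intro u v huv
  have h := (D.τ_strictMono (Fin.castSucc_lt_succ (i := s))).le
  unfold exposure
  rcases le_total u (D.τ s.succ) with h1 | h1 <;> rcases le_total v (D.τ s.succ) with h2 | h2 <;>
  rcases le_total u (D.τ s.castSucc) with h3 | h3 <;>
  rcases le_total v (D.τ s.castSucc) with h4 | h4 <;>
  simp only [min_eq_left, min_eq_right, h1, h2, h3, h4] <;> linarith

lemma exposure_zero (s : Fin k) : D.exposure s 0 = 0 := by
  have h (i) : 0 ≤ D.τ i := D.t_nonneg _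
  simp [exposure, h]

lemma sum_exposure {u : ℝ} (h0 : 0 ≤ u) (hu : u ≤ D.t (Fin.last L)) :
    ∑ s, D.exposure s u = u := by
  have key : ∀ (n : ℕ) (f : Fin (n + 1) → ℝ),
      ∑ s : Fin n, (f s.succ - f s.castSucc) = f (Fin.last n) - f 0 := by
    intro n
    induction n with
    | zero => intro f; simp
    | succ n ih =>
      intro f
      rw [Fin.sum_univ_castSucc]
      have := ih (fun i => f i.castSucc)
      simp only [Fin.succ_castSucc, Fin.succ_last] at this ⊢
      rw [this]
      simp
  have := key k (fun i => min u (D.τ i))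
  unfold exposure
  rw [this, D.τ_zero, D.τ_last, min_eq_left hu, min_eq_right h0, sub_zero]

lemma exposure_succ_sub_castSucc (s r : Fin k) :
    D.exposure r (D.τ s.succ) - D.exposure r (D.τ s.castSucc) =
      if r = s then D.τ s.succ - D.τ s.castSucc else 0 := by
  have hm := D.τ_strictMono.monotone
  have hs := hm (Fin.castSucc_lt_succ (i := s)).le
  have hr := hm (Fin.castSucc_lt_succ (i := r)).le
  unfold exposure
  rcases lt_trichotomy r s with h | h | h
  · have h1 : D.τ r.succ ≤ D.τ s.castSucc := hm (by simpa [Fin.le_def] using h)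
    rw [if_neg h.ne, min_eq_right (by linarith), min_eq_right (by linarith), min_eq_right h1,
      min_eq_right (by linarith)]
    ring
  · subst h
    simp [hr]
  · have h1 : D.τ s.succ ≤ D.τ r.castSucc := hm (by simpa [Fin.le_def] using h)
    rw [if_neg h.ne', min_eq_left (by linarith), min_eq_left h1, min_eq_left (by linarith),
      min_eq_left (by linarith)]
    ring

/-- Between two consecutive stress changes only one level accrues exposure, so differencing isolates
a single coefficient `w s`. -/
lemma sum_mul_exposure_sub (w : Fin k → ℝ) (s : Fin k) :
    ∑ r, w r * D.exposure r (D.τ s.succ) - ∑ r, w r * D.exposure r (D.τ s.castSucc) =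
      w s * (D.τ s.succ - D.τ s.castSucc) := by
  rw [← Finset.sum_sub_distrib]
  simp_rw [← mul_sub, D.exposure_succ_sub_castSucc s]
  simp

lemma stage_spec {u : ℝ} (hu : 0 ≤ u) :
    D.τ (D.stage u).castSucc ≤ u ∧ ∀ s, D.stage u < s → u < D.τ s.castSucc := by
  have : NeZero k := ⟨by have := D.two_le; omega⟩
  set F := Finset.univ.filter fun i : Fin k => D.τ i.castSucc ≤ u with hF
  have hst : D.stage u = F.sup id := rfl
  have hne : F.Nonempty := ⟨0, by simp [hF, D.τ_zero, hu]⟩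
  obtain ⟨i, hi, he⟩ := Finset.exists_mem_eq_sup F hne id
  rw [hst]
  constructor
  · rw [he]; simpa [hF] using hi
  · intro s hs
    by_contra! hc
    have : s ≤ F.sup id := Finset.le_sup (f := id) (by simpa [hF] using hc)
    exact absurd hs this.not_gt

lemma exposure_eq {u : ℝ} (h0 : 0 ≤ u) (hu : u ≤ D.t (Fin.last L)) (s : Fin k) :
    D.exposure s u = if s < D.stage u then D.τ s.succ - D.τ s.castSucc
      else if s = D.stage u then u - D.τ s.castSucc else 0 := by
  obtain ⟨h1, h2⟩ := D.stage_spec h0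
  have hm := D.τ_strictMono.monotone
  have hs := hm (Fin.castSucc_lt_succ (i := s)).le
  unfold exposure
  rcases lt_trichotomy s (D.stage u) with h | h | h
  · have h3 : D.τ s.succ ≤ D.τ (D.stage u).castSucc := hm (by simpa [Fin.le_def] using h)
    rw [if_pos h, min_eq_right (by linarith), min_eq_right (by linarith)]
  · rw [if_neg h.not_lt, if_pos h, min_eq_right (a := u) (b := D.τ s.castSucc) (by rw [h]; exact h1)]
    congr 1
    apply min_eq_left
    -- The last stage is never followed by another, so there the bound comes from `u ≤ t_L = τ_k`;
    -- at any earlier stage the next level has not started yet.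
    by_cases hk : (s : ℕ) + 1 = k
    · have : s.succ = Fin.last k := by ext; simpa using hk
      rw [this, D.τ_last]; exact hu
    · have hlt : (s : ℕ) + 1 < k := by have := s.2; omega
      have := h2 ⟨s + 1, hlt⟩ (by rw [← h]; simp [Fin.lt_def])
      exact this.le
  · have h3 := h2 s h
    rw [if_neg h.not_gt, if_neg h.ne', min_eq_left (by linarith), min_eq_left h3.le, sub_self]

lemma sum_mul_exposure {u : ℝ} (h0 : 0 ≤ u) (hu : u ≤ D.t (Fin.last L)) (w : Fin k → ℝ) :
    ∑ s, w s * D.exposure s u =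
      (∑ s ∈ Finset.Iio (D.stage u), w s * (D.τ s.succ - D.τ s.castSucc)) +
        w (D.stage u) * (u - D.τ (D.stage u).castSucc) := by
  have h (s : Fin k) : w s * D.exposure s u =
      (if s < D.stage u then w s * (D.τ s.succ - D.τ s.castSucc) else 0) +
        if s = D.stage u then w s * (u - D.τ s.castSucc) else 0 := by
    rw [D.exposure_eq h0 hu]
    split_ifs with h1 h2 <;> simp_all
  simp_rw [h, Finset.sum_add_distrib]
  congr 1
  · rw [← Finset.sum_filter]
    congr 1
    ext; simp
  · simp

variable {θ : Fin 2 → ℝ}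

/-- The shift `a` converts earlier exposure to the current rate, so the exponent in `G` is the
hazard accumulated over all stages. -/
lemma rate_mul_age (hθ : θ ∈ paramSpace) {u : ℝ} (h0 : 0 ≤ u) (hu : u ≤ D.t (Fin.last L)) :
    D.rate θ (D.stage u) * (u + D.a θ (D.stage u) - D.τ (D.stage u).castSucc) =
      D.cumHazard θ u := by
  have hr := (D.rate_pos hθ (D.stage u)).ne'
  rw [cumHazard, D.sum_mul_exposure h0 hu, a]
  field_simp
  simp_rw [mul_comm (D.rate θ _) (_ - _)]
  ring

/-- The right-hand side is the derivative of the cumulative hazard in `θ₁`; `aStar` corrects for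
earlier levels having their own `x s` instead of the current one. -/
lemma rate_mul_age_deriv (hθ : θ ∈ paramSpace) {u : ℝ} (h0 : 0 ≤ u)
    (hu : u ≤ D.t (Fin.last L)) :
    D.rate θ (D.stage u) *
        ((u + D.a θ (D.stage u) - D.τ (D.stage u).castSucc) * D.x (D.stage u) +
          D.aStar θ (D.stage u)) =
      ∑ s, D.rate θ s * D.x s * D.exposure s u := by
  have hr := (D.rate_pos hθ (D.stage u)).ne'
  rw [mul_add, ← mul_assoc, D.rate_mul_age hθ h0 hu, cumHazard, D.sum_mul_exposure h0 hu,
    D.sum_mul_exposure h0 hu (fun s => D.rate θ s * D.x s), aStar, ← mul_assoc,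
    mul_one_div_cancel hr, one_mul, add_mul, Finset.sum_mul, add_right_comm,
    ← Finset.sum_add_distrib]
  congr 1
  · exact Finset.sum_congr rfl fun s _ => by ring
  · ring

lemma G_eq (hθ : θ ∈ paramSpace) (j : Fin (L + 1)) :
    D.G θ (D.t j) = 1 - Real.exp (-D.cumHazard θ (D.t j)) := by
  rw [G, neg_mul, D.rate_mul_age hθ (D.t_nonneg j) (D.t_le_last j)]

/-- Probability that a device survives the `j`-th inspection time. -/
def survival (θ : Fin 2 → ℝ) (j : Fin (L + 1)) : ℝ := Real.exp (-D.cumHazard θ (D.t j))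

lemma survival_zero (θ : Fin 2 → ℝ) : D.survival θ 0 = 1 := by
  simp [survival, cumHazard, D.t_zero, exposure_zero]

lemma cellProb_eq (hθ : θ ∈ paramSpace) :
    D.cellProb θ = fun j => Fin.lastCases (motive := fun _ => ℝ) (D.survival θ (Fin.last L))
      (fun j : Fin L => D.survival θ j.castSucc - D.survival θ j.succ) j := by
  funext j
  induction j using Fin.lastCases with
  | last => simp [cellProb, D.G_eq hθ, survival]
  | cast j => simp [cellProb, D.G_eq hθ, survival]

lemma z_eq (hθ : θ ∈ paramSpace) (j : Fin (L + 1)) :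
    D.z θ j = D.survival θ j •
      ![D.cumHazard θ (D.t j) / θ 0, ∑ s, D.rate θ s * D.x s * D.exposure s (D.t j)] := by
  by_cases hj : j = 0
  · subst hj
    ext i
    fin_cases i <;> simp [z, cumHazard, D.t_zero, exposure_zero]
  · have h1 := D.rate_mul_age hθ (D.t_nonneg j) (D.t_le_last j)
    have h2 := D.rate_mul_age_deriv hθ (D.t_nonneg j) (D.t_le_last j)
    rw [z, if_neg hj]
    simp only [g, neg_mul, h1, ← h2, survival]
    rw [← h1]
    ext i
    fin_cases i <;> simp <;> ring

lemma row_W (θ : Fin 2 → ℝ) (j : Fin (L + 1)) :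
    (D.W θ).row j = Fin.lastCases (motive := fun _ => Fin 2 → ℝ) (-D.z θ (Fin.last L))
      (fun j : Fin L => -D.z θ j.castSucc - -D.z θ j.succ) j := by
  ext i
  rw [Matrix.row_apply, W, Matrix.of_apply]
  induction j using Fin.lastCases with
  | last => simp
  | cast j =>
    simp only [Fin.lastCases_castSucc, Pi.sub_apply, Pi.neg_apply]
    ring

lemma sum_cellProb_Ici (hθ : θ ∈ paramSpace) (j : Fin (L + 1)) :
    ∑ i ∈ Finset.Ici j, D.cellProb θ i = D.survival θ j := by
  rw [D.cellProb_eq hθ]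
  exact sum_Ici_lastCases_sub _ j

lemma sum_cellProb (hθ : θ ∈ paramSpace) : ∑ i, D.cellProb θ i = 1 := by
  rw [← D.survival_zero θ, ← D.sum_cellProb_Ici hθ 0]
  congr 1
  ext; simp

lemma sum_row_W_Ici (θ : Fin 2 → ℝ) (j : Fin (L + 1)) :
    ∑ i ∈ Finset.Ici j, (D.W θ).row i = -D.z θ j := by
  simp_rw [row_W]
  exact sum_Ici_lastCases_sub (fun j => -D.z θ j) j

lemma sum_row_W (θ : Fin 2 → ℝ) : ∑ i, (D.W θ).row i = 0 := by
  have h : -D.z θ 0 = 0 := by simp [z]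
  rw [← h, ← D.sum_row_W_Ici θ 0]
  congr 1
  ext; simp

/-- Infinitesimal form of the fact that the cell probabilities add up to one. -/
lemma sum_W_mulVec (θ v : Fin 2 → ℝ) : ∑ j, (D.W θ *ᵥ v) j = 0 := by
  have h : ∑ j, (D.W θ *ᵥ v) j = (∑ j, (D.W θ).row j) ⬝ᵥ v := by
    rw [sum_dotProduct]; rfl
  rw [h, sum_row_W, zero_dotProduct]

/-- Exposures are monotone and add up to elapsed time, so at least one of them strictly increases.
-/
lemma cumHazard_lt (hθ : θ ∈ paramSpace) (j : Fin L) :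
    D.cumHazard θ (D.t j.castSucc) < D.cumHazard θ (D.t j.succ) := by
  have ht := D.t_strictMono (Fin.castSucc_lt_succ (i := j))
  have hle (s : Fin k) := D.exposure_mono s ht.le
  refine Finset.sum_lt_sum (fun s _ => mul_le_mul_of_nonneg_left (hle s) (D.rate_pos hθ s).le) ?_
  by_contra! hc
  have : ∑ s, D.exposure s (D.t j.succ) ≤ ∑ s, D.exposure s (D.t j.castSucc) :=
    Finset.sum_le_sum fun s hs => le_of_mul_le_mul_left (hc s hs) (D.rate_pos hθ s)
  rw [D.sum_exposure (D.t_nonneg _) (D.t_le_last _),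
    D.sum_exposure (D.t_nonneg _) (D.t_le_last _)] at this
  linarith

lemma cellProb_pos (hθ : θ ∈ paramSpace) (j : Fin (L + 1)) : 0 < D.cellProb θ j := by
  rw [D.cellProb_eq hθ]
  induction j using Fin.lastCases with
  | last => simp [survival, Real.exp_pos]
  | cast j => simpa [survival] using D.cumHazard_lt hθ j

/-- Tail sums give `z_j ⬝ᵥ v = 0`, so the hazard has zero derivative along `v` at every inspection.
Differencing over each stage leaves `v 0 / θ 0 + x_s * v 1 = 0`, and two distinct stress levels
force `v = 0`. -/
lemma W_mulVec_injective (hθ : θ ∈ paramSpace) {v : Fin 2 → ℝ} (hv : D.W θ *ᵥ v = 0) :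
    v = 0 := by
  have h1 (j : Fin (L + 1)) : D.z θ j ⬝ᵥ v = 0 := by
    rw [← neg_eq_zero, ← neg_dotProduct, ← D.sum_row_W_Ici θ j, sum_dotProduct]
    exact Finset.sum_eq_zero fun i _ => congrFun hv i
  have h2 (j : Fin (L + 1)) :
      ∑ s, D.rate θ s * (v 0 / θ 0 + D.x s * v 1) * D.exposure s (D.t j) = 0 := by
    have := h1 j
    rw [D.z_eq hθ, smul_dotProduct, smul_eq_mul, mul_eq_zero] at this
    have := this.resolve_left (Real.exp_pos _).ne'
    simp only [dotProduct, Fin.sum_univ_two, Matrix.cons_val_zero, Matrix.cons_val_one,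
      cumHazard, Finset.sum_div, Finset.sum_mul] at this
    rw [← this, ← Finset.sum_add_distrib]
    exact Finset.sum_congr rfl fun s _ => by ring
  have h3 (s : Fin k) : v 0 / θ 0 + D.x s * v 1 = 0 := by
    have := D.sum_mul_exposure_sub (fun s => D.rate θ s * (v 0 / θ 0 + D.x s * v 1)) s
    have hτ := sub_pos.2 (D.τ_strictMono (Fin.castSucc_lt_succ (i := s)))
    rw [τ, h2, τ, h2, sub_zero, eq_comm] at this
    have := (mul_eq_zero.1 this).resolve_right hτ.ne'
    exact (mul_eq_zero.1 this).resolve_left (D.rate_pos hθ s).ne'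
  have hk := D.two_le
  have a0 := h3 ⟨0, by omega⟩
  have a1 := h3 ⟨1, by omega⟩
  have hx : D.x ⟨0, by omega⟩ < D.x ⟨1, by omega⟩ := D.x_strictMono (by simp)
  have hv1 : v 1 = 0 := by
    have : (D.x ⟨1, by omega⟩ - D.x ⟨0, by omega⟩) * v 1 = 0 := by linarith
    exact (mul_eq_zero.1 this).resolve_left (sub_pos.2 hx).ne'
  have hv0 : v 0 = 0 := by
    rw [hv1, mul_zero, add_zero] at a0
    exact (div_eq_zero_iff.1 a0).resolve_right (ne_of_gt hθ)
  ext i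
  fin_cases i
  · exact hv0
  · exact hv1

/-! ### Differentiability and continuous inversion of the cell probabilities -/

lemma isOpen_paramSpace : IsOpen paramSpace :=
  isOpen_lt continuous_const (continuous_apply 0)

lemma hasFDerivAt_survival (hθ : θ ∈ paramSpace) (j : Fin (L + 1)) :
    HasFDerivAt (fun η => D.survival η j)
      (-(D.z θ j 0 • ContinuousLinearMap.proj (R := ℝ) (φ := fun _ : Fin 2 => ℝ) 0 +
        D.z θ j 1 • ContinuousLinearMap.proj (R := ℝ) (φ := fun _ : Fin 2 => ℝ) 1)) θ := by
  have h0 := hasFDerivAt_apply (𝕜 := ℝ) (0 : Fin 2) θ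
  have h1 := hasFDerivAt_apply (𝕜 := ℝ) (1 : Fin 2) θ
  have hH := HasFDerivAt.fun_sum (u := Finset.univ) fun (s : Fin k) _ =>
    (h0.mul (h1.mul_const (D.x s)).exp).mul_const (D.exposure s (D.t j))
  refine hH.neg.exp.congr_fderiv ?_
  have hθ0 : θ 0 ≠ 0 := ne_of_gt hθ
  ext v
  simp only [D.z_eq hθ, survival, cumHazard, rate, _root_.smul_apply,
    _root_.neg_apply, _root_.sum_apply, _root_.add_apply,
    ContinuousLinearMap.proj_apply, Pi.smul_apply, Matrix.cons_val_zero, Matrix.cons_val_one,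
    smul_eq_mul, Finset.sum_div, Pi.mul_apply, mul_assoc]
  rw [← mul_add, mul_neg]
  congr 2
  rw [Finset.sum_mul, Finset.sum_mul, ← Finset.sum_add_distrib]
  refine Finset.sum_congr rfl fun s _ => ?_
  field_simp
  ring

lemma hasFDerivAt_cellProb (hθ : θ ∈ paramSpace) :
    HasFDerivAt D.cellProb (LinearMap.toContinuousLinearMap (D.W θ).mulVecLin) θ := by
  have he : (fun η j => Fin.lastCases (motive := fun _ => ℝ) (D.survival η (Fin.last L))
      (fun j : Fin L => D.survival η j.castSucc - D.survival η j.succ) j) =ᶠ[𝓝 θ]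
      D.cellProb := by
    filter_upwards [isOpen_paramSpace.mem_nhds hθ] with η hη
    exact (D.cellProb_eq hη).symm
  refine HasFDerivAt.congr_of_eventuallyEq ?_ he.symm
  refine hasFDerivAt_pi'.2 fun j => ?_
  have hrow (v : Fin 2 → ℝ) : (D.W θ *ᵥ v) j =
      (Fin.lastCases (motive := fun _ => Fin 2 → ℝ) (-D.z θ (Fin.last L))
        (fun j : Fin L => -D.z θ j.castSucc - -D.z θ j.succ) j) ⬝ᵥ v := by
    rw [← row_W]; rfl
  induction j using Fin.lastCases with
  | last =>
    simp only [Fin.lastCases_last]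
    refine (D.hasFDerivAt_survival hθ _).congr_fderiv ?_
    ext v
    simp [hrow, dotProduct]
  | cast j =>
    simp only [Fin.lastCases_castSucc]
    refine ((D.hasFDerivAt_survival hθ _).sub (D.hasFDerivAt_survival hθ _)).congr_fderiv ?_
    ext v
    simp [hrow, dotProduct]
    ring

lemma continuousAt_W (hθ : θ ∈ paramSpace) : ContinuousAt D.W θ := by
  have hz (j : Fin (L + 1)) : ContinuousAt (fun η => D.z η j) θ := by
    have he : (fun η : Fin 2 → ℝ => D.survival η j •
        ![D.cumHazard η (D.t j) / η 0, ∑ s, D.rate η s * D.x s * D.exposure s (D.t j)]) =ᶠ[𝓝 θ]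
        fun η => D.z η j := by
      filter_upwards [isOpen_paramSpace.mem_nhds hθ] with η hη
      exact (D.z_eq hη j).symm
    refine ContinuousAt.congr ?_ he
    have hθ0 : θ 0 ≠ 0 := ne_of_gt hθ
    unfold survival cumHazard rate
    refine continuousAt_pi.2 fun i => ?_
    fin_cases i
    · simp only [Fin.zero_eta, Pi.smul_apply, Matrix.cons_val_zero, smul_eq_mul]
      exact ContinuousAt.mul (by fun_prop)
        (ContinuousAt.div (by fun_prop) (continuous_apply 0).continuousAt hθ0)
    · simp only [Fin.mk_one, Pi.smul_apply, Matrix.cons_val_one, smul_eq_mul]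
      fun_prop
  have hz' (j : Fin (L + 1)) (i : Fin 2) : ContinuousAt (fun η => D.z η j i) θ :=
    continuousAt_pi.1 (hz j) i
  refine continuousAt_pi.2 fun j => continuousAt_pi.2 fun i => ?_
  have hrow (η : Fin 2 → ℝ) : D.W η j i = (D.W η).row j i := rfl
  simp_rw [hrow, row_W]
  induction j using Fin.lastCases with
  | last =>
    simp only [Fin.lastCases_last, Pi.neg_apply]
    exact (hz' (Fin.last L) i).neg
  | cast j =>
    simp only [Fin.lastCases_castSucc, Pi.sub_apply, Pi.neg_apply]
    exact (hz' _ i).neg.sub (hz' _ i).neg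

/-- The parameter is an explicit continuous function of the cells: logarithms of tail sums give
hazards, their increments over stages give rates, and the log-rates at two levels determine `θ₁`,
then `θ₀`. -/
lemma tendsto_of_tendsto_cellProb {ι : Type*} {F : Filter ι} {η : ι → Fin 2 → ℝ}
    (hθ : θ ∈ paramSpace) (hη : ∀ᶠ i in F, η i ∈ paramSpace)
    (h : Tendsto (fun i => D.cellProb (η i)) F (𝓝 (D.cellProb θ))) : Tendsto η F (𝓝 θ) := by
  have hS (j : Fin (L + 1)) :
      Tendsto (fun i => D.cumHazard (η i) (D.t j)) F (𝓝 (D.cumHazard θ (D.t j))) := by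
    have h1 : Tendsto (fun i => ∑ r ∈ Finset.Ici j, D.cellProb (η i) r) F
        (𝓝 (∑ r ∈ Finset.Ici j, D.cellProb θ r)) :=
      tendsto_finsetSum _ fun r _ => tendsto_pi_nhds.1 h r
    rw [D.sum_cellProb_Ici hθ] at h1
    have h2 := (h1.log (Real.exp_pos _).ne').neg
    rw [survival, Real.log_exp, neg_neg] at h2
    refine h2.congr' ?_
    filter_upwards [hη] with i hi
    rw [D.sum_cellProb_Ici hi, survival, Real.log_exp, neg_neg]
  have hR (s : Fin k) : Tendsto (fun i => D.rate (η i) s) F (𝓝 (D.rate θ s)) := by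
    have hτ := sub_pos.2 (D.τ_strictMono (Fin.castSucc_lt_succ (i := s)))
    have key (ξ : Fin 2 → ℝ) : D.rate ξ s =
        (D.cumHazard ξ (D.t (D.l s.succ)) - D.cumHazard ξ (D.t (D.l s.castSucc))) /
          (D.τ s.succ - D.τ s.castSucc) := by
      rw [eq_div_iff hτ.ne', ← D.sum_mul_exposure_sub (D.rate ξ) s]
      rfl
    simp_rw [key]
    exact ((hS _).sub (hS _)).div_const _
  have hk := D.two_le
  have hx : D.x ⟨0, by omega⟩ < D.x ⟨1, by omega⟩ := D.x_strictMono (by simp)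
  have key {ξ : Fin 2 → ℝ} (hξ : ξ ∈ paramSpace) :
      ξ 1 = (Real.log (D.rate ξ ⟨1, by omega⟩) - Real.log (D.rate ξ ⟨0, by omega⟩)) /
        (D.x ⟨1, by omega⟩ - D.x ⟨0, by omega⟩) := by
    have hξ' : ξ 0 ≠ 0 := ne_of_gt hξ
    rw [eq_div_iff (sub_pos.2 hx).ne', rate, rate, Real.log_mul hξ' (Real.exp_pos _).ne',
      Real.log_mul hξ' (Real.exp_pos _).ne', Real.log_exp, Real.log_exp]
    ring
  have h1 : Tendsto (fun i => η i 1) F (𝓝 (θ 1)) := by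
    rw [key hθ]
    refine Tendsto.congr' ?_ ((((hR _).log (D.rate_pos hθ _).ne').sub
      ((hR _).log (D.rate_pos hθ _).ne')).div_const _)
    filter_upwards [hη] with i hi
    exact (key hi).symm
  have h0 : Tendsto (fun i => η i 0) F (𝓝 (θ 0)) := by
    have key (ξ : Fin 2 → ℝ) :
        ξ 0 = D.rate ξ ⟨0, by omega⟩ * Real.exp (-(ξ 1 * D.x ⟨0, by omega⟩)) := by
      rw [rate, mul_assoc, ← Real.exp_add]; simp
    rw [key θ]
    refine Tendsto.congr (fun i => (key (η i)).symm) ((hR _).mul ?_)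
    exact (Real.continuous_exp.tendsto _).comp (h1.mul_const _).neg
  refine tendsto_pi_nhds.2 fun i => ?_
  fin_cases i
  · exact h0
  · exact h1

end StepStress

/-! ### Separation and differentiation of the divergence -/

section Divergence

/-- For `q > 0` this is the strict Bernoulli inequality for `(p / q) ^ (1 + β)`, multiplied by `q ^
(1 + β)`. -/
lemma rpow_bernoulli_gap {β p q : ℝ} (hβ : 0 < β) (hp : 0 ≤ p) (hq : 0 ≤ q) (hpq : p ≠ q) :
    0 < q ^ (1 + β) - (1 + 1 / β) * (p * q ^ β) + 1 / β * p ^ (β + 1) := by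
  rcases hq.eq_or_lt with rfl | hq
  · have hp' : 0 < p := lt_of_le_of_ne hp (Ne.symm hpq)
    rw [Real.zero_rpow (by linarith), Real.zero_rpow hβ.ne']
    simp only [mul_zero, sub_zero, zero_add]
    positivity
  · have h1 := one_add_mul_self_lt_rpow_one_add (s := p / q - 1) (p := 1 + β)
      (by have := div_nonneg hp hq.le; linarith)
      (by rw [sub_ne_zero, Ne, div_eq_one_iff_eq hq.ne']; exact hpq) (by linarith)
    rw [add_sub_cancel, Real.div_rpow hp hq.le, lt_div_iff₀ (by positivity), add_comm 1 β,
      Real.rpow_add_one hq.ne'] at h1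
    rw [add_comm 1 β, Real.rpow_add_one hq.ne']
    have h2 : (1 + (β + 1) * (p / q - 1)) * (q ^ β * q) =
        (β + 1) * p * q ^ β - β * (q ^ β * q) := by
      field_simp
      ring
    rw [h2] at h1
    have h3 : q ^ β * q - (1 + 1 / β) * (p * q ^ β) + 1 / β * p ^ (β + 1) =
        (p ^ (β + 1) - ((β + 1) * p * q ^ β - β * (q ^ β * q))) / β := by
      field_simp
      ring
    rw [h3]
    exact div_pos (sub_pos.2 h1) hβ

/-- Apply `log x ≤ x - 1` to `√q / √p`. Unlike the logarithmic term, the Hellinger term is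
continuous up to `q = 0`; the extra `p - q` cancels when summed over probability vectors. -/
lemma hellinger_le_mul_log {p q : ℝ} (hp : 0 ≤ p) (hq : 0 < q) :
    (√p - √q) ^ 2 + p - q ≤ p * Real.log (p / q) := by
  rcases hp.eq_or_lt with rfl | hp
  · simp [Real.sq_sqrt hq.le]
  · have hsp := Real.sqrt_pos.2 hp
    have hsq := Real.sqrt_pos.2 hq
    have h1 := Real.log_le_sub_one_of_pos (div_pos hsq hsp)
    have h2 : Real.log (p / q) = -(2 * Real.log (√q / √p)) := by
      rw [Real.log_div hp.ne' hq.ne', Real.log_div hsq.ne' hsp.ne', Real.log_sqrt hp.le,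
        Real.log_sqrt hq.le]
      ring
    have h3 : p * (√q / √p - 1) = √p * √q - p := by
      nth_rewrite 1 [← Real.mul_self_sqrt hp.le]
      field_simp
      rw [mul_sub, Real.mul_self_sqrt hp.le]
    have h4 := mul_le_mul_of_nonneg_left h1 hp.le
    rw [h2]
    nlinarith [Real.sq_sqrt hp.le, Real.sq_sqrt hq.le]

/-- A continuous function vanishing only on the diagonal; summed over the cells it is a lower
bound of the divergence. -/
def dpdGap (β p q : ℝ) : ℝ :=
  if β = 0 then (√p - √q) ^ 2
  else q ^ (1 + β) - (1 + 1 / β) * (p * q ^ β) + 1 / β * p ^ (β + 1)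

lemma dpdGap_pos {β p q : ℝ} (hβ : 0 ≤ β) (hp : 0 ≤ p) (hq : 0 ≤ q) (hpq : p ≠ q) :
    0 < dpdGap β p q := by
  unfold dpdGap
  split_ifs with h
  · have : √p - √q ≠ 0 := by rwa [sub_ne_zero, Ne, Real.sqrt_inj hp hq]
    positivity
  · exact rpow_bernoulli_gap (lt_of_le_of_ne hβ (Ne.symm h)) hp hq hpq

lemma dpdGap_self {β p : ℝ} (hβ : 0 ≤ β) (hp : 0 ≤ p) : dpdGap β p p = 0 := by
  unfold dpdGap
  split_ifs with h
  · simp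
  · have hβ' : 0 < β := lt_of_le_of_ne hβ (Ne.symm h)
    rcases hp.eq_or_lt with rfl | hp
    · simp [Real.zero_rpow (show 1 + β ≠ 0 by linarith), Real.zero_rpow (show β + 1 ≠ 0 by linarith)]
    · rw [add_comm 1 β, Real.rpow_add_one hp.ne']
      ring

lemma dpdGap_nonneg {β p q : ℝ} (hβ : 0 ≤ β) (hp : 0 ≤ p) (hq : 0 ≤ q) : 0 ≤ dpdGap β p q := by
  rcases eq_or_ne p q with rfl | h
  · exact (dpdGap_self hβ hp).ge
  · exact (dpdGap_pos hβ hp hq h).le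

lemma continuous_dpdGap {β : ℝ} (hβ : 0 ≤ β) : Continuous fun x : ℝ × ℝ => dpdGap β x.1 x.2 := by
  unfold dpdGap
  split_ifs with h
  · fun_prop
  · have h1 := Real.continuous_rpow_const (q := 1 + β) (by linarith)
    have h2 := Real.continuous_rpow_const (q := β + 1) (by linarith)
    have h3 := Real.continuous_rpow_const hβ
    fun_prop

variable {ι : Type*} [Fintype ι]

lemma sum_dpdGap_le_dpd (β : ℝ) {p q : ι → ℝ} (hp : p ∈ stdSimplex ℝ ι)
    (hq : q ∈ stdSimplex ℝ ι) (hq0 : ∀ j, 0 < q j) : ∑ j, dpdGap β (p j) (q j) ≤ dpd β p q := by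
  unfold dpdGap dpd
  split_ifs with h
  · have h1 : ∑ j, ((√(p j) - √(q j)) ^ 2 + p j - q j) = ∑ j, (√(p j) - √(q j)) ^ 2 := by
      rw [Finset.sum_sub_distrib, Finset.sum_add_distrib, hp.2, hq.2]; ring
    rw [← h1]
    exact Finset.sum_le_sum fun j _ => hellinger_le_mul_log (hp.1 j) (hq0 j)
  · rfl

/-- Pairs in the unit square at distance at least `ε` form a compact set, on which the continuous
positive `dpdGap` has a positive minimum. The resulting `γ` is uniform in both arguments. -/
lemma exists_dpd_lt_imp_dist_lt {β : ℝ} (hβ : 0 ≤ β) {ε : ℝ} (hε : 0 < ε) :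
    ∃ γ > 0, ∀ p ∈ stdSimplex ℝ ι, ∀ q ∈ stdSimplex ℝ ι, (∀ j, 0 < q j) → dpd β p q < γ →
      dist p q < ε := by
  set S : Set (ℝ × ℝ) := (Set.Icc 0 1 ×ˢ Set.Icc 0 1) ∩ {x | ε ≤ dist x.1 x.2} with hS
  have hSc : IsCompact S :=
    (isCompact_Icc.prod isCompact_Icc).inter_right (isClosed_le (by fun_prop) (by fun_prop))
  obtain ⟨γ, hγ, hlow⟩ : ∃ γ > 0, ∀ x ∈ S, γ ≤ dpdGap β x.1 x.2 := by
    rcases S.eq_empty_or_nonempty with h | h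
    · exact ⟨1, one_pos, by simp [h]⟩
    · obtain ⟨x, hx, hmin⟩ := hSc.exists_isMinOn h (continuous_dpdGap hβ).continuousOn
      refine ⟨_, dpdGap_pos hβ hx.1.1.1 hx.1.2.1 ?_, fun y hy => hmin hy⟩
      rw [← dist_pos]
      exact hε.trans_le hx.2
  refine ⟨γ, hγ, fun p hp q hq hq0 hlt => (dist_pi_lt_iff hε).2 fun j => ?_⟩
  by_contra! hc
  have h1 := hlow (p j, q j)
    ⟨⟨⟨hp.1 j, (mem_Icc_of_mem_stdSimplex hp j).2⟩, ⟨hq.1 j, (mem_Icc_of_mem_stdSimplex hq j).2⟩⟩,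
      hc⟩
  have h2 : dpdGap β (p j) (q j) ≤ ∑ i, dpdGap β (p i) (q i) :=
    Finset.single_le_sum (f := fun i => dpdGap β (p i) (q i))
      (fun i _ => dpdGap_nonneg hβ (hp.1 i) (hq.1 i)) (Finset.mem_univ j)
  exact absurd hlt (h1.trans (h2.trans (sum_dpdGap_le_dpd β hp hq hq0))).not_gt

lemma dpd_self {β : ℝ} (hβ : 0 ≤ β) {p : ι → ℝ} (hp : ∀ j, 0 < p j) : dpd β p p = 0 := by
  unfold dpd
  split_ifs with h
  · simp [div_self (hp _).ne']
  · refine Finset.sum_eq_zero fun j _ => ?_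
    have := dpdGap_self hβ (hp j).le
    rwa [dpdGap, if_neg h] at this

lemma continuousAt_dpd_left {β : ℝ} (hβ : 0 ≤ β) {q : ι → ℝ} (hq : ∀ j, 0 < q j) :
    ContinuousAt (fun p => dpd β p q) q := by
  unfold dpd
  split_ifs with h
  · refine tendsto_finsetSum _ fun j _ => ?_
    have h1 : ContinuousAt (fun p : ι → ℝ => p j) q := (continuous_apply j).continuousAt
    exact h1.mul ((h1.div_const _).log (div_pos (hq j) (hq j)).ne')
  · have h2 := Real.continuous_rpow_const (q := β + 1) (by linarith)
    fun_prop

/-- At `β = 0` the derivative is `-p / x = (x - p) / x - 1`. Splitting off the constant gives one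
formula for all `β`; the constant later disappears because the columns of `W` sum to zero. -/
lemma hasDerivAt_dpd_term (β p : ℝ) {x : ℝ} (hx : 0 < x) :
    HasDerivAt (fun q : ℝ => if β = 0 then p * Real.log (p / q)
        else q ^ (1 + β) - (1 + 1 / β) * (p * q ^ β) + 1 / β * p ^ (β + 1))
      ((1 + β) * (x ^ (β - 1) * (x - p)) - if β = 0 then 1 else 0) x := by
  split_ifs with h
  · subst h
    have hval : (1 + (0 : ℝ)) * (x ^ ((0 : ℝ) - 1) * (x - p)) - 1 = p * (0 - x⁻¹) := by
      rw [zero_sub, Real.rpow_neg_one]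
      field_simp
      ring
    rw [hval]
    rcases eq_or_ne p 0 with rfl | hp
    · simpa using hasDerivAt_const x (0 : ℝ)
    · refine (((hasDerivAt_const x (Real.log p)).sub
        (Real.hasDerivAt_log hx.ne')).const_mul p).congr_of_eventuallyEq ?_
      filter_upwards [lt_mem_nhds hx] with q hq
      rw [Real.log_div hp hq.ne']
      rfl
  · have h1 := Real.hasDerivAt_rpow_const (x := x) (p := 1 + β) (Or.inl hx.ne')
    have h2 := Real.hasDerivAt_rpow_const (x := x) (p := β) (Or.inl hx.ne')
    convert! (h1.sub ((h2.const_mul p).const_mul (1 + 1 / β))).add_const (1 / β * p ^ (β + 1))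
      using 1
    rw [add_sub_cancel_left, sub_zero]
    have h3 : x ^ β = x ^ (β - 1) * x := by
      rw [← Real.rpow_add_one hx.ne', sub_add_cancel]
    rw [h3]
    field_simp
    ring

lemma hasFDerivAt_dpd {E : Type*} [NormedAddCommGroup E] [NormedSpace ℝ E] (β : ℝ) (p : ι → ℝ)
    {q : E → ι → ℝ} {q' : E →L[ℝ] ι → ℝ} {θ : E} (hq : HasFDerivAt q q' θ)
    (hpos : ∀ j, 0 < q θ j) :
    HasFDerivAt (fun η => dpd β p (q η))
      (∑ j, ((1 + β) * (q θ j ^ (β - 1) * (q θ j - p j)) - if β = 0 then 1 else 0) •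
        (ContinuousLinearMap.proj (R := ℝ) (φ := fun _ : ι => ℝ) j).comp q') θ := by
  have h := HasFDerivAt.fun_sum (u := Finset.univ) fun (j : ι) _ =>
    (hasDerivAt_dpd_term β (p j) (hpos j)).comp_hasFDerivAt θ (hasFDerivAt_pi'.1 hq j)
  refine h.congr_of_eventuallyEq (Eventually.of_forall fun η => ?_)
  unfold dpd
  split_ifs <;> simp_all

end Divergence

/-! ### Linearisation of an estimating equation -/

section Expansion

open Asymptotics

/-- First-order expansion of the root `h` of an estimating equation `T (w - y) = 0`, where
`w` is differentiable in `h` with derivative `W₀`. -/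
lemma isLittleO_sub_of_estimating_equation {ι E F G : Type*} [NormedAddCommGroup E]
    [NormedSpace ℝ E] [NormedAddCommGroup F] [NormedSpace ℝ F] [NormedAddCommGroup G]
    [NormedSpace ℝ G] {l : Filter ι} {h : ι → E} {y w : ι → F} {T : ι → F →L[ℝ] G}
    {T₀ : F →L[ℝ] G} (W₀ : E →L[ℝ] F) (A : G →L[ℝ] E) (hT : Tendsto T l (𝓝 T₀))
    (hroot : ∀ᶠ i in l, T i (w i - y i) = 0) (hw : (fun i => w i - W₀ (h i)) =o[l] h)
    (hA : ∀ v, A (T₀ (W₀ v)) = v) : (fun i => h i - A (T₀ (y i))) =o[l] y := by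
  -- Nothing is known yet about the size of `h` relative to `y`, so errors are first measured
  -- against the sum of both norms.
  set g : ι → ℝ := fun i => ‖h i‖ + ‖y i‖ with hg
  have hhg : h =O[l] g := .of_norm_le fun i => by simp [hg]
  have hyg : y =O[l] g := .of_norm_le fun i => by simp [hg]
  have hwg : (fun i => w i - W₀ (h i)) =o[l] g := hw.trans_isBigO hhg
  have hwy : (fun i => w i - y i) =O[l] g := by
    have h1 : (fun i => W₀ (h i)) =O[l] g := (W₀.isBigO_comp h l).trans hhg
    simpa using (hwg.isBigO.add h1).sub hyg
  -- At a root `T₀ (w - y) = (T₀ - T i) (w - y)`, a vanishing operator norm times `O(g)`.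
  have hT' : (fun i => T₀ (w i - y i)) =o[l] g := by
    have h1 : (fun i => T₀ - T i) =o[l] (fun _ => (1 : ℝ)) := by
      rw [isLittleO_one_iff]
      simpa using (tendsto_const_nhds (x := T₀)).sub hT
    have h2 : (fun i => (T₀ - T i) (w i - y i)) =O[l]
        fun i => ‖T₀ - T i‖ * ‖w i - y i‖ :=
      .of_norm_le fun i => (T₀ - T i).le_opNorm _
    have h3 := h2.trans_isLittleO (h1.norm_left.mul_isBigO hwy.norm_left)
    simp only [one_mul] at h3
    refine h3.congr' ?_ .rfl
    filter_upwards [hroot] with i hi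
    simp [hi]
  have hmain : (fun i => h i - A (T₀ (y i))) =o[l] g := by
    have h1 : (fun i => A (T₀ (w i - y i)) - A (T₀ (w i - W₀ (h i)))) =o[l] g :=
      ((A.isBigO_comp _ l).trans_isLittleO hT').sub
        (((A.comp T₀).isBigO_comp _ l).trans_isLittleO hwg)
    refine h1.congr_left fun i => ?_
    simp only [map_sub, hA]
    abel
  refine hmain.trans_isBigO ?_
  have h1 : (fun i => A (T₀ (y i))) =O[l] y := (A.comp T₀).isBigO_comp y l
  obtain ⟨C, hC⟩ := h1.bound
  -- Taking the little-o constant `1/2` lets half of `‖h‖` be absorbed: `‖h‖ ≤ (2C + 1) ‖y‖`, hence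
  -- `g ≤ (2C + 2) ‖y‖`.
  refine .of_bound (2 * C + 2) ?_
  filter_upwards [hC, hmain.def (c := 1 / 2) (by norm_num)] with i h2 h3
  have h4 := norm_sub_norm_le (h i) (A (T₀ (y i)))
  have h5 : 0 ≤ g i := by positivity
  rw [Real.norm_of_nonneg h5] at h3 ⊢
  simp only [hg] at h3 ⊢
  linarith

end Expansion

/-! ### Continuity of matrix operations -/

lemma continuousAt_matrix_mul {X a b c : Type*} [TopologicalSpace X] [Fintype b] {x : X}
    {A : X → Matrix a b ℝ} {B : X → Matrix b c ℝ} (hA : ContinuousAt A x)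
    (hB : ContinuousAt B x) : ContinuousAt (fun y => A y * B y) x := by
  refine continuousAt_pi.2 fun i => continuousAt_pi.2 fun j => ?_
  simp only [Matrix.mul_apply]
  exact tendsto_finsetSum _ fun r _ => (continuousAt_pi.1 (continuousAt_pi.1 hA i) r).mul
    (continuousAt_pi.1 (continuousAt_pi.1 hB r) j)

lemma continuousAt_matrix_transpose {X a b : Type*} [TopologicalSpace X] {x : X}
    {A : X → Matrix a b ℝ} (hA : ContinuousAt A x) : ContinuousAt (fun y => (A y)ᵀ) x :=
  continuousAt_pi.2 fun i => continuousAt_pi.2 fun j =>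
    continuousAt_pi.1 (continuousAt_pi.1 hA j) i

lemma continuousAt_matrix_diagonal {X a : Type*} [TopologicalSpace X] [DecidableEq a] {x : X}
    {d : X → a → ℝ} (hd : ContinuousAt d x) :
    ContinuousAt (fun y => Matrix.diagonal (d y)) x := by
  refine continuousAt_pi.2 fun i => continuousAt_pi.2 fun j => ?_
  by_cases h : i = j
  · simpa [h] using continuousAt_pi.1 hd j
  · simpa [h] using continuousAt_const

/-! ### Existence, consistency and linearisation of the estimator -/

namespace StepStress

open Asymptotics

variable {k L : ℕ} (D : StepStress k L) {β : ℝ} {θ₀ : Fin 2 → ℝ}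

lemma cellProb_mem_stdSimplex {θ : Fin 2 → ℝ} (hθ : θ ∈ paramSpace) :
    D.cellProb θ ∈ stdSimplex ℝ (Fin (L + 1)) :=
  ⟨fun j => (D.cellProb_pos hθ j).le, D.sum_cellProb hθ⟩

lemma continuousAt_dpd_cellProb (β : ℝ) (p : Fin (L + 1) → ℝ) {θ : Fin 2 → ℝ}
    (hθ : θ ∈ paramSpace) : ContinuousAt (fun η => dpd β p (D.cellProb η)) θ :=
  (hasFDerivAt_dpd β p (D.hasFDerivAt_cellProb hθ) (D.cellProb_pos hθ)).continuousAt

/-- The parameter space is not compact, but outside a small closed ball around `θ₀` the divergence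
is at least `γ`, while at `θ₀` it is below `γ`. A minimizer over the ball is therefore global. -/
lemma exists_isMinOn_dpd (hβ : 0 ≤ β) (hθ₀ : θ₀ ∈ paramSpace) :
    ∀ᶠ p in 𝓝 (D.cellProb θ₀), p ∈ stdSimplex ℝ (Fin (L + 1)) →
      ∃ θ ∈ paramSpace, IsMinOn (fun η => dpd β p (D.cellProb η)) paramSpace θ := by
  obtain ⟨r, hr, hball⟩ :=
    Metric.nhds_basis_closedBall.mem_iff.1 (isOpen_paramSpace.mem_nhds hθ₀)
  obtain ⟨ε, hε, hinv⟩ : ∃ ε > 0, ∀ θ ∈ paramSpace, dist (D.cellProb θ) (D.cellProb θ₀) < ε →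
      θ ∈ Metric.closedBall θ₀ r := by
    -- The identity along this pulled-back filter turns the convergence statement into continuity of
    -- the inverse of `cellProb`.
    have h := D.tendsto_of_tendsto_cellProb
      (F := comap D.cellProb (𝓝 (D.cellProb θ₀)) ⊓ 𝓟 paramSpace) (η := id) hθ₀
      (mem_inf_of_right (mem_principal_self _)) (tendsto_comap.mono_left inf_le_left)
    have h1 := h.eventually (Metric.closedBall_mem_nhds θ₀ hr)
    rw [eventually_inf_principal, eventually_comap] at h1
    obtain ⟨ε, hε, h2⟩ := Metric.eventually_nhds_iff.1 h1
    exact ⟨ε, hε, fun θ hθ hd => h2 hd θ rfl hθ⟩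
  obtain ⟨γ, hγ, hsep⟩ := exists_dpd_lt_imp_dist_lt (ι := Fin (L + 1)) hβ (half_pos hε)
  have hsmall : ∀ᶠ p in 𝓝 (D.cellProb θ₀), dpd β p (D.cellProb θ₀) < γ := by
    have := (continuousAt_dpd_left hβ (D.cellProb_pos hθ₀)).tendsto
    rw [dpd_self hβ (D.cellProb_pos hθ₀)] at this
    exact this.eventually (gt_mem_nhds hγ)
  filter_upwards [hsmall, Metric.ball_mem_nhds _ (half_pos hε)] with p hp1 hp2 hp
  obtain ⟨θ, hθ, hmin⟩ := (isCompact_closedBall θ₀ r).exists_isMinOn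
    ⟨θ₀, Metric.mem_closedBall_self hr.le⟩ (f := fun η => dpd β p (D.cellProb η))
    fun η hη => (D.continuousAt_dpd_cellProb β p (hball hη)).continuousWithinAt
  refine ⟨θ, hball hθ, fun η hη => ?_⟩
  by_cases hηr : η ∈ Metric.closedBall θ₀ r
  · exact hmin hηr
  · have h1 : ¬ dpd β p (D.cellProb η) < γ := fun hlt => by
      have h2 := hsep p hp _ (D.cellProb_mem_stdSimplex hη) (D.cellProb_pos hη) hlt
      refine hηr (hinv η hη ?_)
      have h3 := dist_triangle_left (D.cellProb η) (D.cellProb θ₀) p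
      have h4 : dist p (D.cellProb θ₀) < ε / 2 := hp2
      linarith
    have h5 : dpd β p (D.cellProb θ) ≤ dpd β p (D.cellProb θ₀) :=
      hmin (Metric.mem_closedBall_self hr.le)
    exact h5.trans (hp1.le.trans (not_lt.1 h1))

variable {ι : Type*} {l : Filter ι} {p : ι → Fin (L + 1) → ℝ} {θ : ι → Fin 2 → ℝ}

/-- The minimal divergence is at most the one at `θ₀`, which tends to zero; separation then brings
the fitted cells close to `p i`, and inversion gives the parameter. -/
lemma tendsto_of_isMinOn_dpd (hβ : 0 ≤ β) (hθ₀ : θ₀ ∈ paramSpace)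
    (hp : Tendsto p l (𝓝 (D.cellProb θ₀))) (hps : ∀ᶠ i in l, p i ∈ stdSimplex ℝ (Fin (L + 1)))
    (hθ : ∀ᶠ i in l, θ i ∈ paramSpace ∧
      IsMinOn (fun η => dpd β (p i) (D.cellProb η)) paramSpace (θ i)) :
    Tendsto θ l (𝓝 θ₀) := by
  refine D.tendsto_of_tendsto_cellProb hθ₀ (hθ.mono fun i h => h.1) ?_
  refine Metric.tendsto_nhds.2 fun ε hε => ?_
  obtain ⟨γ, hγ, hsep⟩ := exists_dpd_lt_imp_dist_lt (ι := Fin (L + 1)) hβ (half_pos hε)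
  have hsmall : ∀ᶠ i in l, dpd β (p i) (D.cellProb θ₀) < γ := by
    have := (continuousAt_dpd_left hβ (D.cellProb_pos hθ₀)).tendsto
    rw [dpd_self hβ (D.cellProb_pos hθ₀)] at this
    exact (this.comp hp).eventually (gt_mem_nhds hγ)
  filter_upwards [hsmall, hps, hθ, Metric.tendsto_nhds.1 hp _ (half_pos hε)] with i h1 h2 h3 h4
  have h5 := hsep _ h2 _ (D.cellProb_mem_stdSimplex h3.1) (D.cellProb_pos h3.1)
    ((h3.2 hθ₀).trans_lt h1)
  have h6 := dist_triangle_left (D.cellProb (θ i)) (D.cellProb θ₀) (p i)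
  linarith

/-- The matrix `Wᵀ D_π^{β-1}` of the estimating equation. -/
def scoreMatrix (β : ℝ) (θ : Fin 2 → ℝ) : Matrix (Fin 2) (Fin (L + 1)) ℝ :=
  (D.W θ)ᵀ * Matrix.diagonal (fun j => D.cellProb θ j ^ (β - 1))

lemma scoreMatrix_mul_W (β : ℝ) (θ : Fin 2 → ℝ) : D.scoreMatrix β θ * D.W θ = D.J β θ := rfl

lemma scoreMatrix_mulVec_of_isMinOn (hβ : 0 ≤ β) {p : Fin (L + 1) → ℝ} {θ : Fin 2 → ℝ}
    (hθ : θ ∈ paramSpace)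
    (hmin : IsMinOn (fun η => dpd β p (D.cellProb η)) paramSpace θ) :
    D.scoreMatrix β θ *ᵥ (D.cellProb θ - p) = 0 := by
  have hd := hasFDerivAt_dpd β p (D.hasFDerivAt_cellProb hθ) (D.cellProb_pos hθ)
  have h0 := (hmin.isLocalMin (isOpen_paramSpace.mem_nhds hθ)).hasFDerivAt_eq_zero hd
  have h1 (v : Fin 2 → ℝ) :
      ∑ j, D.cellProb θ j ^ (β - 1) * (D.cellProb θ j - p j) * (D.W θ *ᵥ v) j = 0 := by
    have h2 := congrArg (fun f => f v) h0
    simp only [_root_.sum_apply, _root_.smul_apply, ContinuousLinearMap.comp_apply,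
      ContinuousLinearMap.proj_apply, LinearMap.coe_toContinuousLinearMap', Matrix.mulVecLin_apply,
      smul_eq_mul, _root_.zero_apply, sub_mul, Finset.sum_sub_distrib, ← Finset.mul_sum,
      D.sum_W_mulVec, mul_zero, sub_zero, mul_assoc] at h2
    have h3 := (mul_eq_zero.1 h2).resolve_left (by linarith)
    rw [← h3]
    exact Finset.sum_congr rfl fun j _ => by ring
  refine dotProduct_eq_zero _ fun v => ?_
  rw [scoreMatrix, ← Matrix.mulVec_mulVec, Matrix.mulVec_transpose, ← Matrix.dotProduct_mulVec,
    ← h1 v]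
  simp [dotProduct, Matrix.mulVec_diagonal]

lemma continuousAt_cellProb (hθ₀ : θ₀ ∈ paramSpace) : ContinuousAt D.cellProb θ₀ :=
  (D.hasFDerivAt_cellProb hθ₀).continuousAt

lemma continuousAt_cellProb_rpow (s : ℝ) (hθ₀ : θ₀ ∈ paramSpace) :
    ContinuousAt (fun θ j => D.cellProb θ j ^ s) θ₀ :=
  continuousAt_pi.2 fun j => (continuousAt_pi.1 (D.continuousAt_cellProb hθ₀) j).rpow_const
    (Or.inl (D.cellProb_pos hθ₀ j).ne')

lemma continuousAt_scoreMatrix (β : ℝ) (hθ₀ : θ₀ ∈ paramSpace) :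
    ContinuousAt (D.scoreMatrix β) θ₀ := by
  exact continuousAt_matrix_mul (continuousAt_matrix_transpose (D.continuousAt_W hθ₀))
    (continuousAt_matrix_diagonal (D.continuousAt_cellProb_rpow (β - 1) hθ₀))

/-- The quadratic form of `J` is a sum of squares of `W v` with positive weights, so the injectivity
of `W` makes it definite. -/
lemma isUnit_det_J (β : ℝ) (hθ₀ : θ₀ ∈ paramSpace) : IsUnit (D.J β θ₀).det := by
  rw [← Matrix.isUnit_iff_isUnit_det, ← Matrix.mulVec_injective_iff_isUnit]
  refine (injective_iff_map_eq_zero (D.J β θ₀).mulVecLin).2 fun v hv => ?_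
  have h1 : v ⬝ᵥ (D.J β θ₀ *ᵥ v) = ∑ j, D.cellProb θ₀ j ^ (β - 1) * (D.W θ₀ *ᵥ v) j ^ 2 := by
    rw [J, Matrix.mul_assoc, ← Matrix.mulVec_mulVec, Matrix.mulVec_transpose,
      dotProduct_comm, ← Matrix.dotProduct_mulVec, ← Matrix.mulVec_mulVec]
    simp only [dotProduct, Matrix.mulVec_diagonal]
    exact Finset.sum_congr rfl fun j _ => by ring
  rw [Matrix.mulVecLin_apply] at hv
  rw [hv, dotProduct_zero, eq_comm, Finset.sum_eq_zero_iff_of_nonneg fun j _ =>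
    mul_nonneg (Real.rpow_nonneg (D.cellProb_pos hθ₀ j).le _) (sq_nonneg _)] at h1
  refine D.W_mulVec_injective hθ₀ (funext fun j => ?_)
  have := (mul_eq_zero.1 (h1 j (Finset.mem_univ j))).resolve_left
    (Real.rpow_pos_of_pos (D.cellProb_pos hθ₀ j) _).ne'
  exact pow_eq_zero_iff two_ne_zero |>.1 this

/-- Asymptotic linearity of minimum divergence estimators. -/
lemma isLittleO_estimator (hβ : 0 ≤ β) (hθ₀ : θ₀ ∈ paramSpace)
    (hp : Tendsto p l (𝓝 (D.cellProb θ₀))) (hps : ∀ᶠ i in l, p i ∈ stdSimplex ℝ (Fin (L + 1)))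
    (hθ : ∀ᶠ i in l, θ i ∈ paramSpace ∧
      IsMinOn (fun η => dpd β (p i) (D.cellProb η)) paramSpace (θ i)) :
    (fun i => θ i - θ₀ - (D.J β θ₀)⁻¹ *ᵥ (D.scoreMatrix β θ₀ *ᵥ (p i - D.cellProb θ₀))) =o[l]
      fun i => p i - D.cellProb θ₀ := by
  have hlim := D.tendsto_of_isMinOn_dpd hβ hθ₀ hp hps hθ
  set Φ : Matrix (Fin 2) (Fin (L + 1)) ℝ →ₗ[ℝ] (Fin (L + 1) → ℝ) →L[ℝ] (Fin 2 → ℝ) :=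
    LinearMap.toContinuousLinearMap.toLinearMap ∘ₗ (Matrix.toLin' (R := ℝ)).toLinearMap with hΦ
  have hΦc : Continuous Φ := Φ.continuous_of_finiteDimensional
  have hΦa (M : Matrix (Fin 2) (Fin (L + 1)) ℝ) (v) : Φ M v = M *ᵥ v := rfl
  have := isLittleO_sub_of_estimating_equation (l := l) (h := fun i => θ i - θ₀)
    (y := fun i => p i - D.cellProb θ₀) (w := fun i => D.cellProb (θ i) - D.cellProb θ₀)
    (T := fun i => Φ (D.scoreMatrix β (θ i))) (T₀ := Φ (D.scoreMatrix β θ₀))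
    (LinearMap.toContinuousLinearMap (D.W θ₀).mulVecLin)
    (LinearMap.toContinuousLinearMap ((D.J β θ₀)⁻¹).mulVecLin)
    ((hΦc.tendsto _).comp ((D.continuousAt_scoreMatrix β hθ₀).tendsto.comp hlim))
    (by
      filter_upwards [hθ] with i hi
      rw [hΦa, sub_sub_sub_cancel_right]
      exact D.scoreMatrix_mulVec_of_isMinOn hβ hi.1 hi.2)
    ((D.hasFDerivAt_cellProb hθ₀).isLittleO.comp_tendsto hlim)
    (by
      intro v
      simp only [hΦa, LinearMap.coe_toContinuousLinearMap', Matrix.mulVecLin_apply,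
        Matrix.mulVec_mulVec, ← Matrix.mul_assoc]
      rw [Matrix.mul_assoc, D.scoreMatrix_mul_W, Matrix.nonsing_inv_mul _ (D.isUnit_det_J β hθ₀),
        Matrix.one_mulVec])
  exact this

/-! ### The asymptotic variance -/

lemma continuousAt_asympVar (β : ℝ) (m : Fin 2 → ℝ) (hθ₀ : θ₀ ∈ paramSpace) :
    ContinuousAt (D.asympVar β m) θ₀ := by
  have hW := D.continuousAt_W hθ₀
  have hJ : ContinuousAt (D.J β) θ₀ :=
    continuousAt_matrix_mul (D.continuousAt_scoreMatrix β hθ₀) hW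
  have hJi : ContinuousAt (fun θ => (D.J β θ)⁻¹) θ₀ := by
    simp_rw [Matrix.inv_def, Ring.inverse_eq_inv']
    have h4 : ContinuousAt (fun θ => (D.J β θ).det) θ₀ :=
      (continuous_id.matrix_det.tendsto _).comp hJ
    have h5 : ContinuousAt (fun θ => (D.J β θ).adjugate) θ₀ :=
      (continuous_id.matrix_adjugate.tendsto _).comp hJ
    exact (h4.inv₀ (D.isUnit_det_J β hθ₀).ne_zero).smul h5
  have hπ := D.continuousAt_cellProb_rpow β hθ₀
  have hv : ContinuousAt (fun θ => Matrix.vecMulVec (fun j => D.cellProb θ j ^ β)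
      (fun j => D.cellProb θ j ^ β)) θ₀ :=
    continuousAt_pi.2 fun i => continuousAt_pi.2 fun j =>
      (continuousAt_pi.1 hπ i).mul (continuousAt_pi.1 hπ j)
  have hK : ContinuousAt (D.K β) θ₀ :=
    continuousAt_matrix_mul (continuousAt_matrix_mul (continuousAt_matrix_transpose hW)
      ((continuousAt_matrix_diagonal
        (D.continuousAt_cellProb_rpow (2 * β - 1) hθ₀)).sub hv)) hW
  have hJKJ := continuousAt_matrix_mul (continuousAt_matrix_mul hJi hK) hJi
  have hterm (i j : Fin 2) : ContinuousAt
      (fun θ => ((D.J β θ)⁻¹ * D.K β θ * (D.J β θ)⁻¹) i j * m j) θ₀ :=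
    (continuousAt_pi.1 (continuousAt_pi.1 hJKJ i) j).mul continuousAt_const
  unfold asympVar dotProduct Matrix.mulVec dotProduct
  exact tendsto_finsetSum _ fun i _ => (tendsto_finsetSum _ fun j _ => hterm i j).const_mul _

/-- Coefficients of the linear approximation of `mᵀ θ̂` in terms of the observed frequencies. -/
def influence (β : ℝ) (m θ : Fin 2 → ℝ) : Fin (L + 1) → ℝ :=
  ((D.J β θ)⁻¹ *ᵥ m) ᵥ* D.scoreMatrix β θ

lemma J_transpose (β : ℝ) (θ : Fin 2 → ℝ) : (D.J β θ)ᵀ = D.J β θ := by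
  simp [J, Matrix.mul_assoc]

lemma dotProduct_inv_J_mulVec (β : ℝ) (m θ : Fin 2 → ℝ) (y : Fin (L + 1) → ℝ) :
    m ⬝ᵥ ((D.J β θ)⁻¹ *ᵥ (D.scoreMatrix β θ *ᵥ y)) = D.influence β m θ ⬝ᵥ y := by
  rw [influence, ← Matrix.dotProduct_mulVec, Matrix.dotProduct_mulVec, ← Matrix.mulVec_transpose,
    Matrix.transpose_nonsing_inv, J_transpose]

/-- Since `J⁻¹ (Wᵀ D_π^{β-1}) W = 1`, the drift `W ℓ` of the frequencies becomes `mᵀ ℓ`, whatever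
`β` is. -/
lemma influence_dotProduct_W (β : ℝ) (m v : Fin 2 → ℝ) (hθ₀ : θ₀ ∈ paramSpace) :
    D.influence β m θ₀ ⬝ᵥ (D.W θ₀ *ᵥ v) = m ⬝ᵥ v := by
  rw [← dotProduct_inv_J_mulVec, Matrix.mulVec_mulVec v (D.scoreMatrix β θ₀) (D.W θ₀),
    scoreMatrix_mul_W, Matrix.mulVec_mulVec,
    Matrix.nonsing_inv_mul _ (D.isUnit_det_J β hθ₀), Matrix.one_mulVec]

lemma influence_apply (β : ℝ) (m θ : Fin 2 → ℝ) (j : Fin (L + 1)) :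
    D.influence β m θ j = D.cellProb θ j ^ (β - 1) * (D.W θ *ᵥ ((D.J β θ)⁻¹ *ᵥ m)) j := by
  rw [influence, scoreMatrix, ← Matrix.vecMul_vecMul, Matrix.vecMul_transpose,
    Matrix.vecMul_diagonal, mul_comm]

/-- The middle factor of `K` is `D_π^{β-1} (D_π - π πᵀ) D_π^{β-1}`, so the sandwich is the variance
of the influence coefficient of a random cell drawn from `π`. -/
lemma asympVar_eq (β : ℝ) (m : Fin 2 → ℝ) (hθ₀ : θ₀ ∈ paramSpace) :
    D.asympVar β m θ₀ = ∑ j, D.cellProb θ₀ j *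
      (D.influence β m θ₀ j - D.influence β m θ₀ ⬝ᵥ D.cellProb θ₀) ^ 2 := by
  set c := D.influence β m θ₀ with hc
  set π := D.cellProb θ₀ with hπ
  set u := D.W θ₀ *ᵥ ((D.J β θ₀)⁻¹ *ᵥ m) with hu
  have hpos (j) : 0 < π j := D.cellProb_pos hθ₀ j
  have h1 : D.asympVar β m θ₀ = u ⬝ᵥ ((Matrix.diagonal (fun j => π j ^ (2 * β - 1)) -
      Matrix.vecMulVec (fun j => π j ^ β) (fun j => π j ^ β)) *ᵥ u) := by
    rw [asympVar, K, ← Matrix.mulVec_mulVec, ← Matrix.mulVec_mulVec, ← Matrix.mulVec_mulVec,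
      ← Matrix.mulVec_mulVec, Matrix.dotProduct_mulVec, ← Matrix.mulVec_transpose,
      Matrix.transpose_nonsing_inv, J_transpose, Matrix.dotProduct_mulVec, Matrix.vecMul_transpose]
  have h2 : ∑ j, π j * (c j - c ⬝ᵥ π) ^ 2 = ∑ j, π j * c j ^ 2 - (c ⬝ᵥ π) ^ 2 := by
    have h3 (j) : π j * (c j - c ⬝ᵥ π) ^ 2 =
        π j * c j ^ 2 - 2 * (c ⬝ᵥ π) * (c j * π j) + (c ⬝ᵥ π) ^ 2 * π j := by ring
    simp_rw [h3]
    rw [Finset.sum_add_distrib, Finset.sum_sub_distrib, ← Finset.mul_sum, ← Finset.mul_sum,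
      D.sum_cellProb hθ₀]
    change _ - 2 * (c ⬝ᵥ π) * (c ⬝ᵥ π) + _ = _
    ring
  rw [h1, h2, Matrix.sub_mulVec, dotProduct_sub]
  congr 1
  · simp only [dotProduct, Matrix.mulVec_diagonal]
    refine Finset.sum_congr rfl fun j _ => ?_
    have h4 : π j ^ (2 * β - 1) = π j * (π j ^ (β - 1)) ^ 2 := by
      rw [← Real.rpow_natCast, ← Real.rpow_mul (hpos j).le, mul_comm (π j),
        ← Real.rpow_add_one (hpos j).ne']
      congr 1
      push_cast
      ring
    rw [hc, influence_apply, h4]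
    ring
  · rw [Matrix.vecMulVec_mulVec]
    have h5 : c ⬝ᵥ π = (fun j => π j ^ β) ⬝ᵥ u := by
      refine Finset.sum_congr rfl fun j _ => ?_
      have h6 : π j ^ β = π j ^ (β - 1) * π j := by
        rw [← Real.rpow_add_one (hpos j).ne', sub_add_cancel]
      simp only [h6]
      rw [hc, influence_apply]
      ring
    rw [h5, dotProduct_smul, dotProduct_comm u]
    simp [sq]

/-- Zero variance makes the influence a constant `κ`, so `W v = κ π^{1-β}` with `v = J⁻¹ m`. The
entries of `W v` sum to zero and the powers are positive, hence `κ = 0`, `v = 0` and `m = J v = 0`.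
-/
lemma asympVar_pos (β : ℝ) {m : Fin 2 → ℝ} (hm : m ≠ 0) (hθ₀ : θ₀ ∈ paramSpace) :
    0 < D.asympVar β m θ₀ := by
  have hpos (j) : 0 < D.cellProb θ₀ j := D.cellProb_pos hθ₀ j
  rw [D.asympVar_eq β m hθ₀]
  refine lt_of_le_of_ne (Finset.sum_nonneg fun j _ => mul_nonneg (hpos j).le (sq_nonneg _)) ?_
  intro h0
  rw [eq_comm, Finset.sum_eq_zero_iff_of_nonneg fun j _ => mul_nonneg (hpos j).le (sq_nonneg _)]
    at h0
  set κ := D.influence β m θ₀ ⬝ᵥ D.cellProb θ₀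
  set v := (D.J β θ₀)⁻¹ *ᵥ m with hv
  have h1 (j) : (D.W θ₀ *ᵥ v) j = κ * D.cellProb θ₀ j ^ (1 - β) := by
    have h2 := (mul_eq_zero.1 (h0 j (Finset.mem_univ j))).resolve_left (hpos j).ne'
    rw [pow_eq_zero_iff two_ne_zero, sub_eq_zero, influence_apply, ← neg_sub 1 β,
      Real.rpow_neg (hpos j).le] at h2
    rw [← h2]
    have := (Real.rpow_pos_of_pos (hpos j) (1 - β)).ne'
    field_simp
    rfl
  have h3 : κ = 0 := by
    have h4 := D.sum_W_mulVec θ₀ v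
    simp_rw [h1] at h4
    rw [← Finset.mul_sum] at h4
    refine (mul_eq_zero.1 h4).resolve_right (ne_of_gt ?_)
    exact Finset.sum_pos (fun j _ => Real.rpow_pos_of_pos (hpos j) _) Finset.univ_nonempty
  have h5 : v = 0 := D.W_mulVec_injective hθ₀ (funext fun j => by simp [h1, h3])
  apply hm
  have h6 : D.J β θ₀ *ᵥ v = m := by
    rw [hv, Matrix.mulVec_mulVec, Matrix.mul_nonsing_inv _ (D.isUnit_det_J β hθ₀),
      Matrix.one_mulVec]
  rw [← h6, h5, Matrix.mulVec_zero]

end StepStress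

/-! ### Central limit theorem for multinomial frequencies -/

section Multinomial

variable {ι : Type*} [Fintype ι]

lemma empirical_mem_stdSimplex {n : ι → ℕ} (hn : n ≠ 0) : empirical n ∈ stdSimplex ℝ ι := by
  refine ⟨fun j => by unfold empirical; positivity, ?_⟩
  have h : ((∑ i, n i : ℕ) : ℝ) ≠ 0 := by
    rw [Nat.cast_ne_zero, Ne, Finset.sum_eq_zero_iff]
    exact fun h => hn (funext fun i => h i (Finset.mem_univ i))
  simp_rw [empirical, ← Finset.sum_div]
  rw [← Nat.cast_sum, div_self h]

/-- With `y = x / √N` the remainder after the quadratic Taylor term is at most `|y|³ e^{|y|}`, and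
`N` times this is `O(1/√N)`. -/
lemma tendsto_natCast_mul_exp_sub (x : ℝ) :
    Tendsto (fun N : ℕ => (N : ℂ) * (Complex.exp ((x / √(N : ℝ) : ℝ) * Complex.I) - 1 -
      (x / √(N : ℝ) : ℝ) * Complex.I)) atTop (𝓝 (-(x ^ 2 / 2 : ℝ))) := by
  rw [tendsto_iff_norm_sub_tendsto_zero]
  have hs : Tendsto (fun N : ℕ => √(N : ℝ)) atTop atTop :=
    Real.tendsto_sqrt_atTop.comp tendsto_natCast_atTop_atTop
  have hb : Tendsto (fun N : ℕ => |x| ^ 3 * Real.exp |x| * (√(N : ℝ))⁻¹) atTop (𝓝 0) := by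
    simpa using (tendsto_inv_atTop_zero.comp hs).const_mul (|x| ^ 3 * Real.exp |x|)
  refine squeeze_zero' (Eventually.of_forall fun _ => norm_nonneg _) ?_ hb
  filter_upwards [eventually_ge_atTop 1] with N hN
  have hN1 : (1 : ℝ) ≤ N := by exact_mod_cast hN
  have hs1 : 1 ≤ √(N : ℝ) := Real.one_le_sqrt.2 hN1
  have hs0 : 0 < √(N : ℝ) := by linarith
  have hsq : √(N : ℝ) ^ 2 = N := Real.sq_sqrt (by linarith)
  set y : ℝ := x / √(N : ℝ) with hy
  have hyx : |y| ≤ |x| := by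
    rw [hy, abs_div, abs_of_pos hs0]
    exact div_le_self (abs_nonneg x) hs1
  have h1 := Complex.norm_exp_sub_sum_le_norm_mul_exp (y * Complex.I) 3
  have h2 : ‖(y : ℂ) * Complex.I‖ = |y| := by simp
  have h3 : (N : ℂ) * (Complex.exp (y * Complex.I) - 1 - y * Complex.I) - -((x ^ 2 / 2 : ℝ) : ℂ) =
      N * (Complex.exp (y * Complex.I) -
        ∑ m ∈ Finset.range 3, (y * Complex.I) ^ m / (m.factorial : ℂ)) := by
    have h4 : ((x ^ 2 / 2 : ℝ) : ℂ) = N * ((y : ℂ) ^ 2 / 2) := by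
      have : x ^ 2 / 2 = N * (y ^ 2 / 2) := by
        rw [hy, div_pow, hsq]
        field_simp
      rw [this]
      push_cast
      rfl
    rw [h4]
    simp [Finset.sum_range_succ, mul_pow]
    ring
  rw [h3, norm_mul, Complex.norm_natCast]
  rw [h2] at h1
  calc (N : ℝ) * _ ≤ N * (|y| ^ 3 * Real.exp |y|) := by gcongr
    _ ≤ N * (|y| ^ 3 * Real.exp |x|) := by gcongr
    _ = _ := by
      rw [hy, abs_div, abs_of_pos hs0, div_pow]
      nth_rewrite 1 [← hsq]
      field_simp

lemma tendsto_sum_exp_pow {p : ℕ → ι → ℝ} {q δ b : ι → ℝ}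
    (hp : ∀ᶠ N in atTop, ∑ j, p N j = 1) (hpq : Tendsto p atTop (𝓝 q))
    (hδ : Tendsto (fun N : ℕ => √(N : ℝ) • (p N - q)) atTop (𝓝 δ)) (hb : ∑ j, q j * b j = 0)
    (t : ℝ) :
    Tendsto (fun N : ℕ => (∑ j, (p N j : ℂ) *
        Complex.exp ((t * b j / √(N : ℝ) : ℝ) * Complex.I)) ^ N) atTop
      (𝓝 (Complex.exp (t * (∑ j, b j * δ j : ℝ) * Complex.I -
        (∑ j, q j * b j ^ 2 : ℝ) * t ^ 2 / 2))) := by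
  set e : ℕ → ι → ℂ := fun N j => (N : ℂ) * (Complex.exp ((t * b j / √(N : ℝ) : ℝ) * Complex.I) -
    1 - (t * b j / √(N : ℝ) : ℝ) * Complex.I) with he
  have h1 : Tendsto (fun N => ∑ j, (p N j : ℂ) * e N j +
      ((t * ∑ j, b j * (√(N : ℝ) • (p N - q)) j : ℝ) : ℂ) * Complex.I) atTop
      (𝓝 (∑ j, (q j : ℂ) * (-((t * b j) ^ 2 / 2 : ℝ)) +
        ((t * ∑ j, b j * δ j : ℝ) : ℂ) * Complex.I)) := by
    refine Tendsto.add ?_ (Tendsto.mul_const _ ?_)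
    · refine tendsto_finsetSum _ fun j _ => Tendsto.mul ?_ (tendsto_natCast_mul_exp_sub (t * b j))
      exact (Complex.continuous_ofReal.tendsto _).comp (tendsto_pi_nhds.1 hpq j)
    · refine (Complex.continuous_ofReal.tendsto _).comp (Tendsto.const_mul _ ?_)
      exact tendsto_finsetSum _ fun j _ => (tendsto_pi_nhds.1 hδ j).const_mul _
  have h2 : ∑ j, (q j : ℂ) * (-((t * b j) ^ 2 / 2 : ℝ)) +
        ((t * ∑ j, b j * δ j : ℝ) : ℂ) * Complex.I = t * (∑ j, b j * δ j : ℝ) * Complex.I -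
        (∑ j, q j * b j ^ 2 : ℝ) * t ^ 2 / 2 := by
    push_cast
    rw [Finset.sum_mul, Finset.sum_div, add_comm, sub_eq_add_neg, ← Finset.sum_neg_distrib]
    congr 1
    exact Finset.sum_congr rfl fun j _ => by ring
  rw [h2] at h1
  have h3 := Complex.tendsto_one_add_pow_exp_of_tendsto
    (g := fun N => (∑ j, (p N j : ℂ) *
        Complex.exp ((t * b j / √(N : ℝ) : ℝ) * Complex.I)) - 1)
    (t := t * (∑ j, b j * δ j : ℝ) * Complex.I - (∑ j, q j * b j ^ 2 : ℝ) * t ^ 2 / 2) ?_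
  · simpa using h3
  · refine h1.congr' ?_
    filter_upwards [hp, eventually_ge_atTop 1] with N hN hN1
    have hN0 : (0 : ℝ) < N := by exact_mod_cast hN1
    have hs0 : 0 < √(N : ℝ) := Real.sqrt_pos.2 hN0
    -- Centring, `∑ q_j b_j = 0`, keeps the first-order term bounded: only the deviation of `p N`
    -- from `q` survives in it.
    have h4 : ∑ j, b j * (√(N : ℝ) • (p N - q)) j = √(N : ℝ) * ∑ j, p N j * b j := by
      have h5 : ∑ j, b j * (√(N : ℝ) • (p N - q)) j =
          √(N : ℝ) * (∑ j, p N j * b j - ∑ j, q j * b j) := by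
        rw [← Finset.sum_sub_distrib, Finset.mul_sum]
        exact Finset.sum_congr rfl fun j _ => by simp; ring
      rw [h5, hb, sub_zero]
    have h6 : ((t * (√(N : ℝ) * ∑ j, p N j * b j) : ℝ) : ℂ) =
        N * ∑ j, (p N j : ℂ) * (t * b j / √(N : ℝ) : ℝ) := by
      have : t * (√(N : ℝ) * ∑ j, p N j * b j) = N * ∑ j, p N j * (t * b j / √(N : ℝ)) := by
        nth_rewrite 2 [← Real.sq_sqrt hN0.le]
        simp_rw [Finset.mul_sum]
        refine Finset.sum_congr rfl fun j _ => ?_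
        field_simp
      rw [this]
      push_cast
      rfl
    have h7 : (1 : ℂ) = ∑ j, (p N j : ℂ) := by rw [← Complex.ofReal_sum, hN, Complex.ofReal_one]
    rw [h4, h6, h7, ← Finset.sum_sub_distrib, Finset.mul_sum, Finset.mul_sum, Finset.sum_mul,
      ← Finset.sum_add_distrib]
    refine Finset.sum_congr rfl fun j _ => ?_
    simp only [he]
    ring

variable [DecidableEq ι]

lemma ae_sum_eq_multinomialLaw (N : ℕ) (p : ι → ℝ) :
    ∀ᵐ n ∂(multinomialLaw N p), ∑ j, n j = N := by
  rw [ae_iff, multinomialLaw, Measure.finsetSum_apply]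
  refine Finset.sum_eq_zero fun n hn => ?_
  rw [Finset.mem_piAntidiag] at hn
  simp [hn.1]

lemma integral_multinomialLaw (N : ℕ) {p : ι → ℝ} (hp : ∀ j, 0 ≤ p j) (f : (ι → ℕ) → ℂ) :
    ∫ n, f n ∂(multinomialLaw N p) =
      ∑ n ∈ Finset.piAntidiag Finset.univ N,
        (Nat.multinomial Finset.univ n : ℂ) * (∏ j, (p j : ℂ) ^ n j) * f n := by
  rw [multinomialLaw, integral_finsetSum_measure]
  · refine Finset.sum_congr rfl fun n _ => ?_
    have h : 0 ≤ (Nat.multinomial Finset.univ n : ℝ) * ∏ j, p j ^ n j :=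
      mul_nonneg (Nat.cast_nonneg _) (Finset.prod_nonneg fun j _ => pow_nonneg (hp j) _)
    rw [integral_smul_measure, integral_dirac, ENNReal.toReal_ofReal h, Complex.real_smul]
    push_cast
    rfl
  · exact fun n _ => (integrable_dirac (by simp)).smul_measure ENNReal.ofReal_ne_top

/-- This is the multinomial theorem; it makes the characteristic function an exact `N`-th power. -/
lemma integral_exp_multinomialLaw (N : ℕ) {p : ι → ℝ} (hp : ∀ j, 0 ≤ p j) (s : ι → ℂ) :
    ∫ n, Complex.exp (∑ j, (n j : ℂ) * s j) ∂(multinomialLaw N p) =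
      (∑ j, (p j : ℂ) * Complex.exp (s j)) ^ N := by
  rw [integral_multinomialLaw N hp, Finset.sum_pow_eq_sum_piAntidiag]
  refine Finset.sum_congr rfl fun n _ => ?_
  rw [Complex.exp_sum, mul_assoc, ← Finset.prod_mul_distrib]
  congr 1
  refine Finset.prod_congr rfl fun j _ => ?_
  rw [mul_pow, Complex.exp_nat_mul]

/-- Central limit theorem for linear functions of multinomial frequencies, where the probability
vector may depend on the number of trials. -/
theorem tendstoInDistribution_multinomial {Ω : Type*} [MeasurableSpace Ω] {μ : Measure Ω}
    [IsProbabilityMeasure μ] {p : ℕ → ι → ℝ} {q δ : ι → ℝ} {X : ℕ → Ω → ι → ℕ}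
    (hp : ∀ᶠ N in atTop, p N ∈ stdSimplex ℝ ι) (hq : q ∈ stdSimplex ℝ ι)
    (hpq : Tendsto p atTop (𝓝 q))
    (hδ : Tendsto (fun N : ℕ => √(N : ℝ) • (p N - q)) atTop (𝓝 δ))
    (hX : ∀ N, AEMeasurable (X N) μ)
    (hlaw : ∀ᶠ N in atTop, HasLaw (X N) (multinomialLaw N (p N)) μ) (c : ι → ℝ) :
    TendstoInDistribution (fun (N : ℕ) ω => √(N : ℝ) * (c ⬝ᵥ (empirical (X N ω) - q))) atTop id
      (fun _ => μ) (gaussianReal (∑ j, (c j - c ⬝ᵥ q) * δ j)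
        (∑ j, q j * (c j - c ⬝ᵥ q) ^ 2).toNNReal) := by
  have hmeas (N : ℕ) : AEMeasurable (fun ω => √(N : ℝ) * (c ⬝ᵥ (empirical (X N ω) - q))) μ :=
    (Measurable.of_discrete (f := fun n : ι → ℕ => √(N : ℝ) * (c ⬝ᵥ (empirical n - q)))
      ).comp_aemeasurable (hX N)
  refine ⟨hmeas, by fun_prop, ?_⟩
  refine ProbabilityMeasure.tendsto_iff_tendsto_charFun.2 fun t => ?_
  simp only [ProbabilityMeasure.coe_mk, Measure.map_id, charFun_gaussianReal]
  -- As the counts sum to `N`, the statistic equals `∑ n_j b_j / √N` with these centred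
  -- coefficients.
  set b : ι → ℝ := fun j => c j - c ⬝ᵥ q with hb
  have hv : 0 ≤ ∑ j, q j * (c j - c ⬝ᵥ q) ^ 2 :=
    Finset.sum_nonneg fun j _ => mul_nonneg (hq.1 j) (sq_nonneg _)
  have hqb : ∑ j, q j * b j = 0 := by
    simp only [hb, mul_sub, Finset.sum_sub_distrib, ← Finset.sum_mul, hq.2, one_mul]
    rw [sub_eq_zero]
    exact Finset.sum_congr rfl fun j _ => mul_comm _ _
  have hcoe : (((∑ j, q j * (c j - c ⬝ᵥ q) ^ 2).toNNReal : NNReal) : ℂ) =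
      ((∑ j, q j * b j ^ 2 : ℝ) : ℂ) := by
    exact congrArg Complex.ofReal (Real.coe_toNNReal _ hv)
  rw [hcoe]
  refine (tendsto_sum_exp_pow (hp.mono fun N h => h.2) hpq hδ hqb t).congr' ?_
  filter_upwards [hp, hlaw, eventually_ge_atTop 1] with N hpN hN hN1
  have hN0 : (0 : ℝ) < N := by exact_mod_cast hN1
  have hs0 : 0 < √(N : ℝ) := Real.sqrt_pos.2 hN0
  rw [charFun_apply_real, integral_map (hmeas N) (by fun_prop), ← integral_exp_multinomialLaw N hpN.1,
    ← hN.map_eq, integral_map (hX N) (Measurable.of_discrete.aestronglyMeasurable)]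
  have hsum : ∀ᵐ ω ∂μ, ∑ j, X N ω j = N := by
    have := ae_sum_eq_multinomialLaw N (p N)
    rw [← hN.map_eq] at this
    exact ae_of_ae_map (hX N) this
  refine integral_congr_ae ?_
  filter_upwards [hsum] with ω hω
  congr 1
  have key : ∑ j, (X N ω j : ℝ) * (t * b j / √(N : ℝ)) =
      t * (√(N : ℝ) * (c ⬝ᵥ (empirical (X N ω) - q))) := by
    have h1 : c ⬝ᵥ empirical (X N ω) = (∑ j, (X N ω j : ℝ) * c j) / N := by
      rw [dotProduct, Finset.sum_div]
      refine Finset.sum_congr rfl fun j _ => ?_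
      rw [empirical, hω]
      ring
    have h2 : ∑ j, (X N ω j : ℝ) = N := by exact_mod_cast hω
    have h3 : ∑ j, (X N ω j : ℝ) * (t * b j / √(N : ℝ)) =
        t / √(N : ℝ) * (∑ j, (X N ω j : ℝ) * c j - (∑ j, (X N ω j : ℝ)) * (c ⬝ᵥ q)) := by
      rw [Finset.sum_mul, ← Finset.sum_sub_distrib, Finset.mul_sum]
      exact Finset.sum_congr rfl fun j _ => by simp only [hb]; ring
    rw [h3, dotProduct_sub, h1, h2]
    have h4 : √(N : ℝ) ^ 2 = N := Real.sq_sqrt hN0.le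
    have h5 : √(N : ℝ) * ((∑ j, (X N ω j : ℝ) * c j) / N - c ⬝ᵥ q) =
        (∑ j, (X N ω j : ℝ) * c j - N * (c ⬝ᵥ q)) / √(N : ℝ) := by
      rw [eq_div_iff hs0.ne']
      field_simp
      rw [h4]
    rw [h5]
    ring
  rw [← Complex.ofReal_mul, ← key]
  push_cast
  rw [Finset.sum_mul]
  exact Finset.sum_congr rfl fun j _ => by ring

end Multinomial

/-! ### Convergence in measure and Slutsky-type arguments -/

section Slutsky

variable {Ω Ω' : Type*} {mΩ : MeasurableSpace Ω} {mΩ' : MeasurableSpace Ω'}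

/-- Portmanteau: the set of points at distance at least `ε` from `0` is closed and misses `0`, so
its frontier is null for the limit law. -/
lemma tendstoInMeasure_zero_of_tendstoInDistribution {μ : Measure Ω} [IsProbabilityMeasure μ]
    {ν : Measure Ω'} [IsProbabilityMeasure ν] {Y : ℕ → Ω → ℝ}
    (h : TendstoInDistribution Y atTop (fun _ : Ω' => (0 : ℝ)) (fun _ => μ) ν) :
    TendstoInMeasure μ Y atTop fun _ => 0 := by
  refine tendstoInMeasure_of_ne_top fun ε hε hεt => ?_
  have hset : MeasurableSet {x : ℝ | ε ≤ edist x 0} :=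
    measurableSet_le measurable_const (by fun_prop)
  have hcl : IsClosed {x : ℝ | ε ≤ edist x 0} :=
    isClosed_le continuous_const (by fun_prop)
  have hfr : (ν.map fun _ : Ω' => (0 : ℝ)) (frontier {x : ℝ | ε ≤ edist x 0}) = 0 := by
    refine measure_mono_null hcl.frontier_subset ?_
    rw [Measure.map_apply measurable_const hset]
    simp [hε.not_ge]
  have h1 := ProbabilityMeasure.tendsto_measure_of_null_frontier_of_tendsto' h.tendsto hfr
  simp only [ProbabilityMeasure.coe_mk] at h1
  rw [Measure.map_apply measurable_const hset] at h1
  simp only [edist_self, Set.preimage_ofPred_eq, nonpos_iff_eq_zero, hε.ne', Set.ofPred_false,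
    measure_empty] at h1
  refine h1.congr fun N => ?_
  rw [Measure.map_apply_of_aemeasurable (h.forall_aemeasurable N) hset]
  rfl

lemma tendstoInMeasure_mul_zero {μ : Measure Ω} [IsProbabilityMeasure μ]
    {ν : Measure Ω'} [IsProbabilityMeasure ν] {X Y : ℕ → Ω → ℝ} {Z : Ω' → ℝ}
    (hX : TendstoInDistribution X atTop Z (fun _ => μ) ν)
    (hY : TendstoInMeasure μ Y atTop fun _ => 0) (hYm : ∀ N, AEMeasurable (Y N) μ) :
    TendstoInMeasure μ (fun N ω => Y N ω * X N ω) atTop fun _ => 0 := by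
  have h := hX.continuous_comp_prodMk_of_tendstoInMeasure_const
    (g := fun x : ℝ × ℝ => x.2 * x.1) (by fun_prop) hY hYm
  simp only [zero_mul] at h
  exact tendstoInMeasure_zero_of_tendstoInDistribution h

lemma tendstoInMeasure_add_zero {μ : Measure Ω} {X Y : ℕ → Ω → ℝ}
    (hX : TendstoInMeasure μ X atTop fun _ => 0) (hY : TendstoInMeasure μ Y atTop fun _ => 0) :
    TendstoInMeasure μ (fun N ω => X N ω + Y N ω) atTop fun _ => 0 := by
  intro ε hε
  have h := (hX (ε / 2) (ENNReal.half_pos hε.ne')).add (hY (ε / 2) (ENNReal.half_pos hε.ne'))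
  rw [add_zero] at h
  refine tendsto_of_tendsto_of_tendsto_of_le_of_le tendsto_const_nhds h (fun _ => zero_le) ?_
  intro N
  refine (measure_mono fun ω hω => ?_).trans (measure_union_le _ _)
  by_contra hc
  simp only [Set.mem_union, Set.mem_ofPred_eq, not_or, not_le] at hc hω
  have h1 : edist (X N ω + Y N ω) 0 ≤ edist (X N ω) 0 + edist (Y N ω) 0 := by
    simpa using edist_add_add_le (X N ω) (Y N ω) 0 0
  have h2 := h1.trans_lt (ENNReal.add_lt_add hc.1 hc.2)
  rw [ENNReal.add_halves] at h2
  exact absurd hω h2.not_ge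

lemma tendstoInMeasure_sum_zero {μ : Measure Ω} {κ : Type*} (s : Finset κ) {X : κ → ℕ → Ω → ℝ}
    (hX : ∀ j, TendstoInMeasure μ (X j) atTop fun _ => 0) :
    TendstoInMeasure μ (fun N ω => ∑ j ∈ s, X j N ω) atTop fun _ => 0 := by
  classical
  induction s using Finset.induction_on with
  | empty =>
    intro ε hε
    simp [hε.ne']
  | insert j s hj ih =>
    simp only [Finset.sum_insert hj]
    exact tendstoInMeasure_add_zero (hX j) ih

lemma tendstoInMeasure_of_tendsto_const {μ : Measure Ω} {a : ℕ → ℝ}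
    (ha : Tendsto a atTop (𝓝 0)) :
    TendstoInMeasure μ (fun N (_ : Ω) => a N) atTop fun _ => 0 := by
  intro ε hε
  refine tendsto_const_nhds.congr' ?_
  filter_upwards [EMetric.tendsto_nhds.1 ha ε hε] with N hN
  simp only [hN.not_ge, Set.ofPred_false, measure_empty]

/-- Convergence in distribution depends on the laws only. -/
lemma tendstoInDistribution_congr_law {E : Type*} [TopologicalSpace E] [MeasurableSpace E]
    [OpensMeasurableSpace E] {Ω₁ Ω₂ : ℕ → Type*} {m₁ : ∀ N, MeasurableSpace (Ω₁ N)}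
    {m₂ : ∀ N, MeasurableSpace (Ω₂ N)} {μ₁ : ∀ N, Measure (Ω₁ N)} {μ₂ : ∀ N, Measure (Ω₂ N)}
    [∀ N, IsProbabilityMeasure (μ₁ N)] [∀ N, IsProbabilityMeasure (μ₂ N)]
    {ν₁ : Measure Ω} {ν₂ : Measure Ω'} [IsProbabilityMeasure ν₁] [IsProbabilityMeasure ν₂]
    {X₁ : ∀ N, Ω₁ N → E} {X₂ : ∀ N, Ω₂ N → E} {Z₁ : Ω → E} {Z₂ : Ω' → E}
    (h : TendstoInDistribution X₁ atTop Z₁ μ₁ ν₁) (hX₂ : ∀ N, AEMeasurable (X₂ N) (μ₂ N))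
    (hZ₂ : AEMeasurable Z₂ ν₂) (hX : ∀ N, (μ₁ N).map (X₁ N) = (μ₂ N).map (X₂ N))
    (hZ : ν₁.map Z₁ = ν₂.map Z₂) :
    TendstoInDistribution X₂ atTop Z₂ μ₂ ν₂ := by
  refine ⟨hX₂, hZ₂, ?_⟩
  have h1 := h.tendsto
  have h2 : (⟨ν₂.map Z₂, Measure.isProbabilityMeasure_map hZ₂⟩ : ProbabilityMeasure E) =
      ⟨ν₁.map Z₁, Measure.isProbabilityMeasure_map h.aemeasurable_limit⟩ := Subtype.ext hZ.symm
  rw [h2]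
  exact h1.congr fun N => Subtype.ext (hX N)

end Slutsky

/-! ### From limits in the frequencies to limits in probability -/

section Frequencies

variable {ι : Type*} [Fintype ι]

/-- Count vectors whose empirical distribution is close to `q`. -/
def countsNear (q : ι → ℝ) : Filter (ι → ℕ) := comap empirical (𝓝 q) ⊓ 𝓟 {n | n ≠ 0}

variable {Ω : Type*} [MeasurableSpace Ω] {μ : Measure Ω} {q : ι → ℝ} {X : ℕ → Ω → ι → ℕ}

/-- The exceptional set lies in the event of zero counts together with finitely many coordinate
deviations, so monotonicity suffices and `Q` needs no measurability. -/
lemma tendsto_measure_not_of_eventually_countsNear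
    (hX0 : ∀ᶠ N in atTop, ∀ᵐ ω ∂μ, X N ω ≠ 0)
    (hXq : ∀ j, TendstoInMeasure μ (fun N ω => empirical (X N ω) j - q j) atTop fun _ => 0)
    {Q : (ι → ℕ) → Prop} (hQ : ∀ᶠ n in countsNear q, Q n) :
    Tendsto (fun N => μ {ω | ¬ Q (X N ω)}) atTop (𝓝 0) := by
  rw [countsNear, eventually_inf_principal, eventually_comap] at hQ
  obtain ⟨ε, hε, hball⟩ := Metric.eventually_nhds_iff.1 hQ
  have h1 : Tendsto (fun N => ∑ j, μ {ω | ENNReal.ofReal ε ≤ edist (empirical (X N ω) j - q j) 0})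
      atTop (𝓝 0) := by
    have := tendsto_finsetSum Finset.univ fun j _ => hXq j (ENNReal.ofReal ε) (by simpa using hε)
    simpa using this
  refine tendsto_of_tendsto_of_tendsto_of_le_of_le' tendsto_const_nhds h1
    (Eventually.of_forall fun _ => zero_le) ?_
  filter_upwards [hX0] with N hN
  have h2 : μ {ω | ¬ Q (X N ω)} ≤ μ ({ω | ¬ X N ω ≠ 0} ∪
      ⋃ j ∈ Finset.univ, {ω | ENNReal.ofReal ε ≤ edist (empirical (X N ω) j - q j) 0}) := by
    refine measure_mono fun ω hω => ?_
    by_contra hc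
    simp only [Set.mem_union, Set.mem_ofPred_eq, Set.mem_iUnion, not_or, not_not, not_exists,
      Finset.mem_univ, not_le, forall_true_left] at hc
    refine hω (hball ((dist_pi_lt_iff hε).2 fun j => ?_) (X N ω) rfl hc.1)
    have := hc.2 j
    rwa [edist_dist, ENNReal.ofReal_lt_ofReal_iff hε, dist_zero_right, ← dist_eq_norm] at this
  refine h2.trans ((measure_union_le _ _).trans ?_)
  rw [ae_iff.1 hN, zero_add]
  exact measure_biUnion_finset_le _ _

lemma tendstoInMeasure_of_tendsto_countsNear
    (hX0 : ∀ᶠ N in atTop, ∀ᵐ ω ∂μ, X N ω ≠ 0)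
    (hXq : ∀ j, TendstoInMeasure μ (fun N ω => empirical (X N ω) j - q j) atTop fun _ => 0)
    {f : (ι → ℕ) → ℝ} {a : ℝ} (hf : Tendsto f (countsNear q) (𝓝 a)) :
    TendstoInMeasure μ (fun N ω => f (X N ω)) atTop fun _ => a := by
  intro ε hε
  have h := tendsto_measure_not_of_eventually_countsNear hX0 hXq
    (EMetric.tendsto_nhds.1 hf ε hε)
  simpa only [not_lt] using h

/-- A function of the frequencies that is of smaller order than their deviation from `q` is
asymptotically negligible at the rate `√N`, if the deviations are of order `1/√N`. -/
lemma tendstoInMeasure_sqrt_mul_of_isLittleO [IsProbabilityMeasure μ]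
    {Ω' : Type*} [MeasurableSpace Ω'] {ν : ι → Measure Ω'} [∀ j, IsProbabilityMeasure (ν j)]
    {Z : ι → Ω' → ℝ} (hX : ∀ N, AEMeasurable (X N) μ)
    (hX0 : ∀ᶠ N in atTop, ∀ᵐ ω ∂μ, X N ω ≠ 0)
    (hXq : ∀ j, TendstoInMeasure μ (fun (N : ℕ) ω => empirical (X N ω) j - q j) atTop fun _ => 0)
    (hd : ∀ j, TendstoInDistribution (fun (N : ℕ) ω => √(N : ℝ) * (empirical (X N ω) j - q j))
      atTop (Z j) (fun _ => μ) (ν j))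
    {f : (ι → ℕ) → ℝ} (hf : f =o[countsNear q] fun n => empirical n - q) :
    TendstoInMeasure μ (fun (N : ℕ) ω => √(N : ℝ) * f (X N ω)) atTop fun _ => 0 := by
  set S : (ι → ℕ) → ℝ := fun n => ∑ j, |empirical n j - q j| with hS
  have hfS : f =o[countsNear q] S := by
    refine hf.trans_isBigO (.of_norm_le fun n => ?_)
    refine (pi_norm_le_iff_of_nonneg (Finset.sum_nonneg fun j _ => abs_nonneg _)).2 fun j => ?_
    exact Finset.single_le_sum (f := fun j => |empirical n j - q j|)
      (fun i _ => abs_nonneg _) (Finset.mem_univ j)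
  have hmeas (g : (ι → ℕ) → ℝ) (N : ℕ) : AEMeasurable (fun ω => g (X N ω)) μ :=
    (Measurable.of_discrete (f := g)).comp_aemeasurable (hX N)
  -- Write `√N f = (f / S) · √N S`: the first factor tends to zero in probability, and the second is
  -- a finite sum of terms converging in law.
  have h1 : TendstoInMeasure μ (fun (N : ℕ) ω => ∑ j, f (X N ω) / S (X N ω) *
      |√(N : ℝ) * (empirical (X N ω) j - q j)|) atTop fun _ => 0 :=
    tendstoInMeasure_sum_zero _ fun j => by
      have ha : TendstoInDistribution
          (fun (N : ℕ) ω => |√(N : ℝ) * (empirical (X N ω) j - q j)|) atTop (fun x => |Z j x|)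
          (fun _ => μ) (ν j) := (hd j).continuous_comp continuous_abs
      have hb : TendstoInMeasure μ (fun (N : ℕ) ω => f (X N ω) / S (X N ω)) atTop fun _ => 0 :=
        tendstoInMeasure_of_tendsto_countsNear (f := fun n => f n / S n) hX0 hXq
          hfS.tendsto_div_nhds_zero
      exact tendstoInMeasure_mul_zero ha hb (hmeas fun n => f n / S n)
  have h2 : TendstoInMeasure μ (fun (N : ℕ) ω => √(N : ℝ) * (f (X N ω) - f (X N ω) / S (X N ω) *
      S (X N ω))) atTop fun _ => 0 := by
    -- Division by `S n = 0` is harmless near `q`: the little-o bound forces `f n = 0` there.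
    have hev : ∀ᶠ n in countsNear q, f n - f n / S n * S n = 0 := by
      filter_upwards [hfS.def one_pos] with n hn
      rcases eq_or_ne (S n) 0 with h0 | h0
      · rw [h0, norm_zero, mul_zero, norm_le_zero_iff] at hn
        simp [hn]
      · rw [div_mul_cancel₀ _ h0, sub_self]
    intro ε hε
    refine tendsto_of_tendsto_of_tendsto_of_le_of_le tendsto_const_nhds
      (tendsto_measure_not_of_eventually_countsNear hX0 hXq hev) (fun _ => zero_le) fun N => ?_
    refine measure_mono fun ω hω hc => ?_
    simp only [Set.mem_ofPred_eq, hc, mul_zero, edist_self, nonpos_iff_eq_zero] at hω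
    exact hε.ne' hω
  have h3 := tendstoInMeasure_add_zero h1 h2
  refine h3.congr_left fun N => Eventually.of_forall fun ω => ?_
  simp only [abs_mul, abs_of_nonneg (Real.sqrt_nonneg _), ← Finset.mul_sum, hS]
  ring

end Frequencies

/-! ### Limit law of the Z-type statistic -/

namespace StepStress

variable {k L : ℕ} (D : StepStress k L) {β : ℝ} {θ₀ m : Fin 2 → ℝ}
  {θhat : (Fin (L + 1) → ℕ) → Fin 2 → ℝ}

/-- Near `cellProb θ₀` a minimizer exists, so the arbitrary values allowed in `IsMDPDE` play no
role. -/
lemma eventually_isMinOn_estimator (hβ : 0 ≤ β) (hθ₀ : θ₀ ∈ paramSpace)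
    (hθhat : D.IsMDPDE β θhat) :
    ∀ᶠ n in countsNear (D.cellProb θ₀), θhat n ∈ paramSpace ∧
      IsMinOn (fun η => dpd β (empirical n) (D.cellProb η)) paramSpace (θhat n) := by
  rw [countsNear, eventually_inf_principal]
  filter_upwards [tendsto_comap.eventually (D.exists_isMinOn_dpd hβ hθ₀)] with n h hn
  exact hθhat n hn (h (empirical_mem_stdSimplex hn))

lemma eventually_empirical_mem_stdSimplex :
    ∀ᶠ n in countsNear (D.cellProb θ₀), empirical n ∈ stdSimplex ℝ (Fin (L + 1)) := by
  rw [countsNear, eventually_inf_principal]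
  exact Eventually.of_forall fun n hn => empirical_mem_stdSimplex hn

lemma tendsto_estimator (hβ : 0 ≤ β) (hθ₀ : θ₀ ∈ paramSpace) (hθhat : D.IsMDPDE β θhat) :
    Tendsto θhat (countsNear (D.cellProb θ₀)) (𝓝 θ₀) :=
  D.tendsto_of_isMinOn_dpd hβ hθ₀ (tendsto_comap.mono_left inf_le_left)
    D.eventually_empirical_mem_stdSimplex (D.eventually_isMinOn_estimator hβ hθ₀ hθhat)

lemma isLittleO_dotProduct_estimator (hβ : 0 ≤ β) (hθ₀ : θ₀ ∈ paramSpace)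
    (hθhat : D.IsMDPDE β θhat) (m : Fin 2 → ℝ) :
    (fun n => m ⬝ᵥ (θhat n - θ₀) -
        D.influence β m θ₀ ⬝ᵥ (empirical n - D.cellProb θ₀)) =o[countsNear (D.cellProb θ₀)]
      fun n => empirical n - D.cellProb θ₀ := by
  have h := D.isLittleO_estimator hβ hθ₀ (tendsto_comap.mono_left inf_le_left)
    D.eventually_empirical_mem_stdSimplex (D.eventually_isMinOn_estimator hβ hθ₀ hθhat)
  have h1 := ((LinearMap.toContinuousLinearMap
    (dotProductBilin ℝ ℝ m : (Fin 2 → ℝ) →ₗ[ℝ] ℝ)).isBigO_comp _ _).trans_isLittleO h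
  refine h1.congr_left fun n => ?_
  change m ⬝ᵥ _ = _
  rw [dotProduct_sub, dotProduct_inv_J_mulVec]

lemma tendsto_sqrt_smul_cellProb_sub (hθ₀ : θ₀ ∈ paramSpace) (v : Fin 2 → ℝ) :
    Tendsto (fun N : ℕ => √(N : ℝ) • (D.cellProb (θ₀ + (1 / √(N : ℝ)) • v) - D.cellProb θ₀))
      atTop (𝓝 (D.W θ₀ *ᵥ v)) := by
  have hs : Tendsto (fun N : ℕ => √(N : ℝ)) atTop atTop :=
    Real.tendsto_sqrt_atTop.comp tendsto_natCast_atTop_atTop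
  have h := ((D.hasFDerivAt_cellProb hθ₀).lim_real v).comp hs
  simp only [one_div]
  exact h

lemma tendsto_localAlternative (θ₀ v : Fin 2 → ℝ) :
    Tendsto (fun N : ℕ => θ₀ + (1 / √(N : ℝ)) • v) atTop (𝓝 θ₀) := by
  have hs : Tendsto (fun N : ℕ => 1 / √(N : ℝ)) atTop (𝓝 0) := by
    simp only [one_div]
    exact tendsto_inv_atTop_zero.comp
      (Real.tendsto_sqrt_atTop.comp tendsto_natCast_atTop_atTop)
  simpa using (hs.smul_const v).const_add θ₀

variable {Ω : Type*} [MeasurableSpace Ω] {μ : Measure Ω} [IsProbabilityMeasure μ]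
  {X : ℕ → Ω → Fin (L + 1) → ℕ} {ℓ : Fin 2 → ℝ}

lemma tendstoInDistribution_linear_frequencies (hθ₀ : θ₀ ∈ paramSpace)
    (hX : ∀ N, AEMeasurable (X N) μ)
    (hlaw : ∀ N : ℕ, 0 < N → θ₀ + (1 / √(N : ℝ)) • ℓ ∈ paramSpace →
      HasLaw (X N) (multinomialLaw N (D.cellProb (θ₀ + (1 / √(N : ℝ)) • ℓ))) μ)
    (c : Fin (L + 1) → ℝ) :
    TendstoInDistribution
      (fun (N : ℕ) ω => √(N : ℝ) * (c ⬝ᵥ (empirical (X N ω) - D.cellProb θ₀))) atTop id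
      (fun _ => μ) (gaussianReal (c ⬝ᵥ (D.W θ₀ *ᵥ ℓ))
        (∑ j, D.cellProb θ₀ j * (c j - c ⬝ᵥ D.cellProb θ₀) ^ 2).toNNReal) := by
  have hev := (tendsto_localAlternative θ₀ ℓ).eventually (isOpen_paramSpace.mem_nhds hθ₀)
  have h := tendstoInDistribution_multinomial (μ := μ) (X := X)
    (hev.mono fun N hN => D.cellProb_mem_stdSimplex hN) (D.cellProb_mem_stdSimplex hθ₀)
    ((D.continuousAt_cellProb hθ₀).tendsto.comp (tendsto_localAlternative θ₀ ℓ))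
    (D.tendsto_sqrt_smul_cellProb_sub hθ₀ ℓ) hX
    (by filter_upwards [hev, eventually_gt_atTop 0] with N h1 h2 using hlaw N h2 h1) c
  -- The centring constant drops out of the mean because the drift `W ℓ` sums to zero.
  simp only [sub_mul, Finset.sum_sub_distrib, ← Finset.mul_sum, D.sum_W_mulVec, mul_zero,
    sub_zero] at h
  exact h

/-- Slutsky's theorem for the estimated standard deviation and the asymptotically linear
estimator. -/
lemma tendstoInDistribution_studentized (hβ : 0 ≤ β) (hm : m ≠ 0) (hθ₀ : θ₀ ∈ paramSpace)
    (hθhat : D.IsMDPDE β θhat) (hX : ∀ N, AEMeasurable (X N) μ)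
    (hlaw : ∀ N : ℕ, 0 < N → θ₀ + (1 / √(N : ℝ)) • ℓ ∈ paramSpace →
      HasLaw (X N) (multinomialLaw N (D.cellProb (θ₀ + (1 / √(N : ℝ)) • ℓ))) μ) (r : ℝ) :
    TendstoInDistribution (fun (N : ℕ) ω => D.asympVar β m (θhat (X N ω)) ^ (-(1 / 2) : ℝ) *
        (√(N : ℝ) * (m ⬝ᵥ (θhat (X N ω) - θ₀)) - r)) atTop id (fun _ => μ)
      (gaussianReal (D.asympVar β m θ₀ ^ (-(1 / 2) : ℝ) * (m ⬝ᵥ ℓ - r)) 1) := by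
  have hCLT := D.tendstoInDistribution_linear_frequencies hθ₀ hX hlaw
  have hev := (tendsto_localAlternative θ₀ ℓ).eventually (isOpen_paramSpace.mem_nhds hθ₀)
  have hX0 : ∀ᶠ N in atTop, ∀ᵐ ω ∂μ, X N ω ≠ 0 := by
    filter_upwards [hev, eventually_gt_atTop 0] with N h1 h2
    have h3 := ae_sum_eq_multinomialLaw N (D.cellProb (θ₀ + (1 / √(N : ℝ)) • ℓ))
    rw [← (hlaw N h2 h1).map_eq] at h3
    filter_upwards [ae_of_ae_map (hX N) h3] with ω hω h0
    rw [h0] at hω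
    simp at hω
    omega
  have hd (j : Fin (L + 1)) := hCLT (Pi.single j 1)
  simp only [single_dotProduct, one_mul, Pi.sub_apply] at hd
  -- The space of counts is discrete, so an arbitrary selection `θhat` causes no measurability
  -- problem.
  have hmeas (g : (Fin (L + 1) → ℕ) → ℝ) (N : ℕ) : AEMeasurable (fun ω => g (X N ω)) μ :=
    (Measurable.of_discrete (f := g)).comp_aemeasurable (hX N)
  have hXq (j : Fin (L + 1)) : TendstoInMeasure μ
      (fun N ω => empirical (X N ω) j - D.cellProb θ₀ j) atTop fun _ => 0 := by
    have hs : Tendsto (fun N : ℕ => (√(N : ℝ))⁻¹) atTop (𝓝 0) :=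
      tendsto_inv_atTop_zero.comp (Real.tendsto_sqrt_atTop.comp tendsto_natCast_atTop_atTop)
    have h1 := tendstoInMeasure_mul_zero (hd j) (tendstoInMeasure_of_tendsto_const hs)
      fun N => aemeasurable_const
    refine TendstoInMeasure.congr' ?_ (Eventually.of_forall fun _ => rfl) h1
    filter_upwards [eventually_gt_atTop 0] with N hN
    refine Eventually.of_forall fun ω => ?_
    have : √(N : ℝ) ≠ 0 := (Real.sqrt_pos.2 (by exact_mod_cast hN)).ne'
    simp only
    rw [inv_mul_cancel_left₀ this]
  have hrem := tendstoInMeasure_sqrt_mul_of_isLittleO hX hX0 hXq hd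
    (D.isLittleO_dotProduct_estimator hβ hθ₀ hθhat m)
  have hvar := D.asympVar_pos β hm hθ₀
  have hsd : Tendsto (fun n => D.asympVar β m (θhat n) ^ (-(1 / 2) : ℝ))
      (countsNear (D.cellProb θ₀)) (𝓝 (D.asympVar β m θ₀ ^ (-(1 / 2) : ℝ))) :=
    ((D.continuousAt_asympVar β m hθ₀).rpow_const (Or.inl hvar.ne')).tendsto.comp
      (D.tendsto_estimator hβ hθ₀ hθhat)
  have h1 := (hCLT (D.influence β m θ₀)).add_of_tendstoInMeasure_const hrem fun N =>
    hmeas (fun n => √(N : ℝ) * (m ⬝ᵥ (θhat n - θ₀) -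
        D.influence β m θ₀ ⬝ᵥ (empirical n - D.cellProb θ₀))) N
  have h2 := h1.continuous_comp_prodMk_of_tendstoInMeasure_const
    (g := fun x : ℝ × ℝ => x.2 * (x.1 - r)) (by fun_prop)
    (tendstoInMeasure_of_tendsto_countsNear hX0 hXq hsd)
    (hmeas fun n => D.asympVar β m (θhat n) ^ (-(1 / 2) : ℝ))
  refine tendstoInDistribution_congr_law h2
    (fun N => hmeas (fun n => D.asympVar β m (θhat n) ^ (-(1 / 2) : ℝ) *
        (√(N : ℝ) * (m ⬝ᵥ (θhat n - θ₀)) - r)) N) aemeasurable_id (fun N => ?_) ?_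
  · congr 1
    ext ω
    simp only [Pi.add_apply]
    ring
  · rw [← D.asympVar_eq β m hθ₀, D.influence_dotProduct_W β m ℓ hθ₀, Measure.map_id]
    simp only [id_eq, add_zero]
    -- The limit is the image of `N(mᵀℓ, σ²)` under `x ↦ s (x - r)`, with `s² σ² = 1`.
    set s := D.asympVar β m θ₀ ^ (-(1 / 2) : ℝ) with hs
    have h3 : (gaussianReal (m ⬝ᵥ ℓ) (D.asympVar β m θ₀).toNNReal).map (fun x => s * (x - r)) =
        ((gaussianReal (m ⬝ᵥ ℓ) (D.asympVar β m θ₀).toNNReal).map (fun x => x - r)).map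
          (fun x => s * x) := by
      rw [Measure.map_map (by fun_prop) (by fun_prop)]
      rfl
    rw [h3, gaussianReal_map_sub_const, gaussianReal_map_const_mul]
    congr 1
    ext
    have h4 : s ^ 2 * D.asympVar β m θ₀ = 1 := by
      rw [hs, ← Real.rpow_natCast, ← Real.rpow_mul hvar.le]
      norm_num
      rw [Real.rpow_neg_one, inv_mul_cancel₀ hvar.ne']
    simpa [hvar.le] using h4

end StepStress

end

theorem theorem13 {k L : ℕ} (D : StepStress k L) (β : ℝ) (hβ : 0 ≤ β)
    (m : Fin 2 → ℝ) (hm : m ≠ 0) (d : ℝ)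
    (θ₀ : Fin 2 → ℝ) (hθ₀ : θ₀ ∈ paramSpace) (hnull : m ⬝ᵥ θ₀ = d)
    (ℓ : Fin 2 → ℝ)
    (θhat : (Fin (L + 1) → ℕ) → Fin 2 → ℝ) (hθhat : D.IsMDPDE β θhat)
    {Ω : ℕ → Type*} [∀ N, MeasurableSpace (Ω N)]
    (P : ∀ N, Measure (Ω N)) [∀ N, IsProbabilityMeasure (P N)]
    (n : ∀ N, Ω N → Fin (L + 1) → ℕ) (hn : ∀ N, AEMeasurable (n N) (P N))
    (hlaw : ∀ N : ℕ, 0 < N → θ₀ + (1 / √(N : ℝ)) • ℓ ∈ paramSpace →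
      HasLaw (n N) (multinomialLaw N (D.cellProb (θ₀ + (1 / √(N : ℝ)) • ℓ))) (P N)) :
    TendstoInDistribution (fun N ω => D.zStat β m d N (θhat (n N ω))) atTop
        id P (gaussianReal (D.asympVar β m θ₀ ^ (-(1 / 2) : ℝ) * (m ⬝ᵥ ℓ)) 1) ∧
      TendstoInDistribution
        (fun N ω => D.zStat β m d N (θhat (n N ω)) -
          D.asympVar β m (θhat (n N ω)) ^ (-(1 / 2) : ℝ) * (m ⬝ᵥ ℓ)) atTop
        id P (gaussianReal 0 1) := by
  -- Only the laws of the counts matter, so they may be realised on one product space.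
  have hprob (N : ℕ) : IsProbabilityMeasure ((P N).map (n N)) :=
    Measure.isProbabilityMeasure_map (hn N)
  set μ := Measure.infinitePi fun N => (P N).map (n N) with hμ
  have hmap (N : ℕ) : μ.map (fun ω => ω N) = (P N).map (n N) :=
    Measure.infinitePi_map_eval (fun N => (P N).map (n N)) N
  have hX (N : ℕ) : AEMeasurable (fun ω : ℕ → Fin (L + 1) → ℕ => ω N) μ :=
    (measurable_pi_apply N).aemeasurable
  have key := D.tendstoInDistribution_studentized (μ := μ) (X := fun N ω => ω N) (ℓ := ℓ)
    hβ hm hθ₀ hθhat hX fun N h1 h2 => ⟨hX N, (hmap N).trans (hlaw N h1 h2).map_eq⟩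
  have transfer (f : ℕ → (Fin (L + 1) → ℕ) → ℝ) (a : ℝ)
      (h : TendstoInDistribution (fun N (ω : ℕ → Fin (L + 1) → ℕ) => f N (ω N)) atTop id
        (fun _ => μ) (gaussianReal a 1)) :
      TendstoInDistribution (fun N ω => f N (n N ω)) atTop id P (gaussianReal a 1) := by
    have hf (N : ℕ) : Measurable (f N) := Measurable.of_discrete
    refine tendstoInDistribution_congr_law h (fun N => (hf N).comp_aemeasurable (hn N))
      aemeasurable_id (fun N => ?_) rfl
    have h1 := AEMeasurable.map_map_of_aemeasurable (hf N).aemeasurable (hX N)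
    have h2 := AEMeasurable.map_map_of_aemeasurable (hf N).aemeasurable (hn N)
    rw [hmap N] at h1
    exact h1.symm.trans h2
  -- Under the null constraint both claims are instances of one studentized limit: `r = 0` keeps the
  -- noncentral mean and `r = mᵀ ℓ` removes it.
  have hz (N : ℕ) (η : Fin 2 → ℝ) (r : ℝ) : D.zStat β m d N η -
      D.asympVar β m η ^ (-(1 / 2) : ℝ) * r =
        D.asympVar β m η ^ (-(1 / 2) : ℝ) * (√(N : ℝ) * (m ⬝ᵥ (η - θ₀)) - r) := by
    rw [StepStress.zStat, dotProduct_sub, hnull]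
    ring
  constructor
  · refine transfer (fun N c => D.zStat β m d N (θhat c)) _ ?_
    have h := key 0
    simp only [← hz] at h
    simpa only [mul_zero, sub_zero] using h
  · refine transfer (fun N c => D.zStat β m d N (θhat c) -
      D.asympVar β m (θhat c) ^ (-(1 / 2) : ℝ) * (m ⬝ᵥ ℓ)) _ ?_
    have h := key (m ⬝ᵥ ℓ)
    simp only [← hz, sub_self, mul_zero] at h
    exact h
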